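/- Let $q,a,k,z\in\mathbb C$ with $|q|<1$ and $a,k,z\neq 0$. Write $(x;q)_n=\prod_{i=0}^{n-1}(1-xq^i)$, $(x;q)_\infty=\prod_{i\ge 0}(1-xq^i)$ and $(x_1,\dots,x_j;q)_n=\prod_{i=1}^{j}(x_i;q)_n$ for $n\in\{0,1,2,\dots\}\cup\{\infty\}$. A pair of sequences $(\alpha_n(a,k),\beta_n(a,k))_{n\ge 0}$ is a WP-Bailey pair (for the parameters $a,k$ and the base $q$) if $\alpha_0(a,k)=\beta_0(a,k)=1$ and, for all $n>0$, $$\beta_n(a,k)=\sum_{j=0}^{n}\frac{(k/a;q)_{n-j}(k;q)_{n+j}}{(q;q)_{n-j}(aq;q)_{n+j}}\,\alpha_j(a,k).$$ Suppose that $(\alpha_n(a,k),\beta_n(a,k))$ is a WP-Bailey pair for the parameters $a,k$, and that $(\alpha_n(1/a,1/k),\beta_n(1/a,1/k))$ is one for the parameters $1/a,1/k$. Assume that no denominator below vanishes, i.e. none of $a$, $k$, $z/a$, $z/k$ is an integer power of $q$ (for $q=0$ the only power meant, besides $0$, is $q^0=1$), that $|qa|<|z|$ and $|qz|<|a|$ (that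 is, $|qa|<|z|<|a/q|$), and that the two series below that contain $\alpha_n(a,k)$ and $\alpha_n(1/a,1/k)$ converge. Then the two series that contain $\beta_n(a,k)$ and $\beta_n(1/a,1/k)$ converge as well, and, for any choice of the square roots $\sqrt{k}$ and $\sqrt{1/k}$, $$\begin{aligned} &\sum_{n=1}^{\infty}\frac{(q\sqrt k,-q\sqrt k,z;q)_n(q;q)_{n-1}}{\left(\sqrt k,-\sqrt k,qk,\frac{qk}{z};q\right)_n}\left(\frac{qa}{z}\right)^n\beta_n(a,k)\\ &-\sum_{n=1}^{\infty}\frac{\left(q\sqrt{\frac1k},-q\sqrt{\frac1k},\frac1z;q\right)_n(q;q)_{n-1}}{\left(\sqrt{\frac1k},-\sqrt{\frac1k},\frac qk,\frac{qz}{k};q\right)_n}\left(\frac{qz}{a}\right)^n\beta_n\!\left(\frac1a,\frac1k\right)\\ &-\sum_{n=1}^{\infty}\frac{(z;q)_n(q;q)_{n-1}}{\left(qa,\frac{qa}{z};q\right)_n}\left(\frac{qa}{z}\right)^n\alpha_n(a,k) +\sum_{n=1}^{\infty}\frac{\left(\frac1z;q\right)_n(q;q)_{n-1}}{\left(\frac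 qa,\frac{qz}{a};q\right)_n}\left(\frac{qz}{a}\right)^n\alpha_n\!\left(\frac1a,\frac1k\right)\\ &=\frac{(a-k)\left(1-\frac1z\right)\left(1-\frac{ak}{z}\right)}{(1-a)(1-k)\left(1-\frac az\right)\left(1-\frac kz\right)} +\frac zk\,\frac{\left(z,\frac qz,\frac ka,\frac{qa}{k},\frac{ak}{z},\frac{qz}{ak},q,q;q\right)_\infty}{\left(\frac zk,\frac{qk}{z},\frac za,\frac{qa}{z},a,\frac qa,k,\frac qk;q\right)_\infty}. \end{aligned}$$ -/

import Mathlib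

noncomputable section

namespace WPBailey

/-- The finite `q`-shifted factorial `(x;q)_n = (1-x)(1-xq)⋯(1-xq^{n-1})`. -/
def qPoch (x q : ℂ) (n : ℕ) : ℂ := ∏ i ∈ Finset.range n, (1 - x * q ^ i)

/-- `(x₁, …, x_j; q)_n = (x₁;q)_n ⋯ (x_j;q)_n`. -/
def qPochs (xs : List ℂ) (q : ℂ) (n : ℕ) : ℂ := (xs.map fun x => qPoch x q n).prod

/-- The infinite product `(x;q)_∞ = ∏_{i ≥ 0} (1 - x q^i)`, absolutely convergent for `|q| < 1`. -/
def qPochInf (x q : ℂ) : ℂ := ∏' i : ℕ, (1 - x * q ^ i)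

/-- `(x₁, …, x_j; q)_∞ = (x₁;q)_∞ ⋯ (x_j;q)_∞`. -/
def qPochsInf (xs : List ℂ) (q : ℂ) : ℂ := (xs.map fun x => qPochInf x q).prod

/-- `(α_n, β_n)` is a WP-Bailey pair for the parameters `a`, `k` and base `q`. -/
structure IsWPBaileyPair (q a k : ℂ) (α β : ℕ → ℂ) : Prop where
  alpha_zero : α 0 = 1
  beta_zero : β 0 = 1
  beta_eq : ∀ n : ℕ, 0 < n →
    β n = ∑ j ∈ Finset.range (n + 1),
      (qPoch (k / a) q (n - j) * qPoch k q (n + j)) /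
        (qPoch q q (n - j) * qPoch (a * q) q (n + j)) * α j

/-- The series `∑_{n ≥ 1} u n` converges (as a limit of partial sums) and has sum `S`. -/
def SeriesHasSum (u : ℕ → ℂ) (S : ℂ) : Prop :=
  Filter.Tendsto (fun N : ℕ => ∑ n ∈ Finset.Icc 1 N, u n) Filter.atTop (nhds S)

end WPBailey

end

noncomputable section

namespace WPBailey

open Filter Topology

/-! Insert the WP-Bailey relation into a `β`-series and collect the coefficient of each `α_j`: it is
a multiple of `∑_m kern q a k z j m`. For `j ≥ 1` this inner sum is `(q;q)_{j-1}`, which reproduces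
the `α`-series exactly; for `j = 0`, where `m` starts at `1`, it is a combination of four Lambert
series. Hence `B - A` involves only Lambert series (`seriesHasSum_beta`), and so does `B' - A'` for
the inverted parameters.

The inner sums come from a telescoping argument: `kern` at `(a,k)` minus `kern` at `(aq,kq)` is a
difference in `m` (`kern_sub_kern_shift`). The sum therefore changes under the shift by a boundary
term only, zero for `j ≥ 1`, and as `N → ∞` the kernel at `(aq^N,kq^N)` keeps only its term `m = 0`.
The `α`-series need not converge absolutely; since the inner sums converge geometrically, uniformly
in `j`, it is enough that the coefficients tend to `0` (`tendsto_sum_triangle`).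

In `(B - A) - (B' - A')` the Lambert series pair up, apart from the rational term, into logarithmic
derivatives `zeta` of the theta function `(x,q/x;q)_∞`. Their four-term combination is a product by
`zeta_addition`, the derivative of the Weierstrass three-term relation at a point where one factor
vanishes. That relation is a Plücker identity, because splitting the Jacobi triple product series by
parity makes `θ(xy)θ(x/y)` equal to `x` times a 2×2 determinant. -/

/-! ### Shifted factorials: limits and uniform bounds. -/

lemma qPoch_zero (x q : ℂ) : qPoch x q 0 = 1 := by simp [qPoch]

lemma qPoch_succ (x q : ℂ) (n : ℕ) : qPoch x q (n + 1) = qPoch x q n * (1 - x * q ^ n) := by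
  simp [qPoch, Finset.prod_range_succ]

lemma qPoch_add (x q : ℂ) (m n : ℕ) :
    qPoch x q (m + n) = qPoch x q m * qPoch (x * q ^ m) q n := by
  simp [qPoch, Finset.prod_range_add, pow_add, mul_assoc]

lemma qPoch_ne_zero {x q : ℂ} (h : ∀ i : ℕ, 1 - x * q ^ i ≠ 0) (n : ℕ) : qPoch x q n ≠ 0 :=
  Finset.prod_ne_zero_iff.mpr fun i _ => h i

lemma qPoch_shift (x q : ℂ) (n : ℕ) :
    (1 - x) * qPoch (x * q) q n = qPoch x q n * (1 - x * q ^ n) := by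
  rw [← qPoch_succ, add_comm n 1, qPoch_add]
  simp [qPoch]

lemma one_sub_mul_pow_ne_zero_shift {x q : ℂ} (h : ∀ i : ℕ, 1 - x * q ^ i ≠ 0) (N i : ℕ) :
    1 - x * q ^ N * q ^ i ≠ 0 := by
  rw [mul_assoc, ← pow_add]; exact h _

lemma one_sub_pow_succ_ne_zero {q : ℂ} (hq : ‖q‖ < 1) (i : ℕ) : 1 - q * q ^ i ≠ 0 := by
  intro h
  have h1 : q ^ (i + 1) = 1 := by rw [pow_succ']; exact (sub_eq_zero.mp h).symm
  have h2 : ‖q‖ ^ (i + 1) < 1 := pow_lt_one₀ (norm_nonneg _) hq (by omega)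
  rw [← norm_pow, h1, norm_one] at h2
  exact lt_irrefl _ h2

lemma summable_norm_mul_pow {q : ℂ} (hq : ‖q‖ < 1) (x : ℂ) :
    Summable fun i : ℕ => ‖x * q ^ i‖ := by
  simp only [norm_mul, norm_pow]
  exact (summable_geometric_of_lt_one (norm_nonneg _) hq).mul_left _

lemma multipliable_qPoch {q : ℂ} (hq : ‖q‖ < 1) (x : ℂ) :
    Multipliable fun i : ℕ => 1 - x * q ^ i := by
  have := multipliable_one_add_of_summable (f := fun i : ℕ => -(x * q ^ i))
    (by simpa only [norm_neg] using summable_norm_mul_pow hq x)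
  simpa only [← sub_eq_add_neg] using this

lemma tendsto_qPoch {q : ℂ} (hq : ‖q‖ < 1) (x : ℂ) :
    Tendsto (fun n => qPoch x q n) atTop (𝓝 (qPochInf x q)) :=
  (multipliable_qPoch hq x).hasProd.tendsto_prod_nat

lemma qPochInf_ne_zero {q x : ℂ} (hq : ‖q‖ < 1) (h : ∀ i : ℕ, 1 - x * q ^ i ≠ 0) :
    qPochInf x q ≠ 0 := by
  unfold qPochInf
  have := tprod_one_add_ne_zero_of_summable (f := fun i : ℕ => -(x * q ^ i))
    (by simpa only [← sub_eq_add_neg] using h)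
    (by simpa only [norm_neg] using summable_norm_mul_pow hq x)
  simpa only [← sub_eq_add_neg] using this

lemma qPochInf_eq_mul_qPochInf {q : ℂ} (hq : ‖q‖ < 1) (x : ℂ) :
    qPochInf x q = (1 - x) * qPochInf (x * q) q := by
  refine tendsto_nhds_unique ((tendsto_add_atTop_iff_nat 1).mpr (tendsto_qPoch hq x)) ?_
  refine ((tendsto_qPoch hq (x * q)).const_mul (1 - x)).congr fun n => ?_
  rw [qPoch_shift, qPoch_succ]

/-- The finite products `(x q^N; q)_n` are bounded uniformly in `N` and `n`. -/
lemma exists_norm_qPoch_le {q : ℂ} (hq : ‖q‖ < 1) (x : ℂ) :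
    ∃ C : ℝ, 0 < C ∧ ∀ N n : ℕ, ‖qPoch (x * q ^ N) q n‖ ≤ C := by
  refine ⟨Real.exp (∑' i : ℕ, ‖x * q ^ i‖), Real.exp_pos _, fun N n => ?_⟩
  calc ‖qPoch (x * q ^ N) q n‖
      ≤ ∏ i ∈ Finset.range n, Real.exp ‖x * q ^ i‖ := by
        rw [qPoch, norm_prod]
        refine Finset.prod_le_prod (fun _ _ => norm_nonneg _) fun i _ => ?_
        have h1 : ‖x * q ^ N * q ^ i‖ ≤ ‖x * q ^ i‖ := by
          simp only [norm_mul, norm_pow]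
          have : ‖q‖ ^ N ≤ 1 := pow_le_one₀ (norm_nonneg _) hq.le
          have h3 : 0 ≤ ‖x‖ * ‖q‖ ^ i := by positivity
          nlinarith
        have h2 := norm_sub_le (1 : ℂ) (x * q ^ N * q ^ i)
        rw [norm_one] at h2
        linarith [Real.add_one_le_exp ‖x * q ^ i‖]
    _ = Real.exp (∑ i ∈ Finset.range n, ‖x * q ^ i‖) := (Real.exp_sum _ _).symm
    _ ≤ _ := Real.exp_le_exp.mpr
        ((summable_norm_mul_pow hq x).sum_le_tsum _ fun _ _ => norm_nonneg _)

/-- The inverses of the finite products `(x q^N; q)_n` are bounded uniformly in `N` and `n`. -/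
lemma exists_norm_inv_qPoch_le {q x : ℂ} (hq : ‖q‖ < 1) (h : ∀ i : ℕ, 1 - x * q ^ i ≠ 0) :
    ∃ C : ℝ, 0 < C ∧ ∀ N n : ℕ, ‖(qPoch (x * q ^ N) q n)⁻¹‖ ≤ C := by
  obtain ⟨C, hC, hle⟩ := exists_norm_qPoch_le hq x
  have hb := Metric.isBounded_range_of_tendsto _
    ((tendsto_qPoch hq x).inv₀ (qPochInf_ne_zero hq h))
  obtain ⟨D, hD, hle'⟩ := hb.exists_pos_norm_le
  refine ⟨D * C, by positivity, fun N n => ?_⟩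
  -- As a quotient of products based at `x`, only the sequence `(x;q)_n⁻¹` has to be bounded, and it
  -- converges.
  have h1 : (qPoch (x * q ^ N) q n)⁻¹ = (qPoch x q (N + n))⁻¹ * qPoch x q N := by
    have := qPoch_ne_zero h N
    rw [qPoch_add]; field_simp
  rw [h1, norm_mul]
  have h2 := hle 0 N
  rw [pow_zero, mul_one] at h2
  exact mul_le_mul (hle' _ ⟨_, rfl⟩) h2 (norm_nonneg _) hD.le

lemma continuous_qPoch (q : ℂ) (n : ℕ) : Continuous fun x => qPoch x q n := by
  unfold qPoch; fun_prop

/-! ### The kernel and its telescoping under `(a,k) ↦ (aq,kq)`. -/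

/-- No denominator of the kernel `kern` vanishes. -/
structure Admissible (q a k z : ℂ) : Prop where
  norm_lt : ‖q‖ < 1
  q_ne : q ≠ 0
  a_ne : a ≠ 0
  z_ne : z ≠ 0
  k_pow : ∀ i : ℕ, 1 - k * q ^ i ≠ 0
  a_pow : ∀ i : ℕ, 1 - a * q ^ i ≠ 0
  kz_pow : ∀ i : ℕ, 1 - k / z * q ^ i ≠ 0
  az_pow : ∀ i : ℕ, 1 - a / z * q ^ i ≠ 0

lemma Admissible.shift {q a k z : ℂ} (h : Admissible q a k z) (N : ℕ) :
    Admissible q (a * q ^ N) (k * q ^ N) z where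
  norm_lt := h.norm_lt
  q_ne := h.q_ne
  a_ne := mul_ne_zero h.a_ne (pow_ne_zero _ h.q_ne)
  z_ne := h.z_ne
  k_pow := one_sub_mul_pow_ne_zero_shift h.k_pow N
  a_pow := one_sub_mul_pow_ne_zero_shift h.a_pow N
  kz_pow i := by
    rw [mul_div_right_comm]; exact one_sub_mul_pow_ne_zero_shift h.kz_pow N i
  az_pow i := by
    rw [mul_div_right_comm]; exact one_sub_mul_pow_ne_zero_shift h.az_pow N i

/-- The coefficient of `α_j` in the term of index `j + m` of the `β`-series, divided by
`(z;q)_j (qa/z)^j / (qa, qa/z;q)_j`. -/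
def kern (q a k z : ℂ) (j m : ℕ) : ℂ :=
  (1 - k * q ^ (2 * (j + m))) * qPoch (z * q ^ j) q m * qPoch q q (j + m - 1) *
    (qPoch (q * a) q j * qPoch (q * a / z) q j) *
    (qPoch (k / a) q m * qPoch k q (2 * j + m)) * (q * a / z) ^ m /
  ((1 - k) * (qPoch (q * k) q (j + m) * qPoch (q * k / z) q (j + m)) *
    (qPoch q q m * qPoch (a * q) q (2 * j + m)))

section

variable {q a k z : ℂ}

lemma Admissible.one_sub_k (h : Admissible q a k z) : 1 - k ≠ 0 := by
  simpa using h.k_pow 0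

lemma Admissible.qk_pow (h : Admissible q a k z) (i : ℕ) : 1 - q * k * q ^ i ≠ 0 := by
  convert h.k_pow (i + 1) using 2; ring

lemma Admissible.qa_pow (h : Admissible q a k z) (i : ℕ) : 1 - q * a * q ^ i ≠ 0 := by
  convert h.a_pow (i + 1) using 2; ring

lemma Admissible.aq_pow (h : Admissible q a k z) (i : ℕ) : 1 - a * q * q ^ i ≠ 0 := by
  convert h.a_pow (i + 1) using 2; ring

lemma Admissible.qkz_pow (h : Admissible q a k z) (i : ℕ) : 1 - q * k / z * q ^ i ≠ 0 := by
  convert h.kz_pow (i + 1) using 2; ring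

lemma Admissible.qaz_pow (h : Admissible q a k z) (i : ℕ) : 1 - q * a / z * q ^ i ≠ 0 := by
  convert h.az_pow (i + 1) using 2; ring

lemma Admissible.q_pow (h : Admissible q a k z) (i : ℕ) : 1 - q * q ^ i ≠ 0 :=
  one_sub_pow_succ_ne_zero h.norm_lt i

/-- The case `j = m = 0` is excluded: there the truncated index `j + m - 1` stays at `0` as `m`
grows to `1`, while the ratio contains `1 - q^(j+m) = 0`. -/
lemma kern_succ (h : Admissible q a k z) (j m : ℕ) (hjm : 1 ≤ j + m) :
    kern q a k z j (m + 1) = kern q a k z j m *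
      ((1 - k * q ^ 2 * (q ^ (j + m)) ^ 2) * (1 - z * q ^ (j + m)) * (1 - q ^ (j + m)) *
        (1 - k / a * q ^ m) * (1 - k * q ^ (2 * j + m)) * (q * a / z) /
      ((1 - k * (q ^ (j + m)) ^ 2) * (1 - q * k * q ^ (j + m)) * (1 - q * k / z * q ^ (j + m)) *
        (1 - q * q ^ m) * (1 - a * q * q ^ (2 * j + m)))) := by
  obtain ⟨n, hn⟩ : ∃ n, j + m = n + 1 := ⟨j + m - 1, by omega⟩
  have e0 : 1 - k * q ^ (2 * (j + (m + 1))) = 1 - k * q ^ 2 * (q ^ (j + m)) ^ 2 := by ring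
  have e1 : qPoch (z * q ^ j) q (m + 1) = qPoch (z * q ^ j) q m * (1 - z * q ^ (j + m)) := by
    rw [qPoch_succ]; ring
  have e2 : qPoch q q (j + (m + 1) - 1) = qPoch q q (j + m - 1) * (1 - q ^ (j + m)) := by
    rw [← add_assoc, hn]
    simp only [Nat.add_sub_cancel]
    rw [qPoch_succ, ← pow_succ']
  have e3 : 1 - k * q ^ (2 * (j + m)) = 1 - k * (q ^ (j + m)) ^ 2 := by ring
  have d0 : 1 - k * (q ^ (j + m)) ^ 2 ≠ 0 := by rw [← e3]; exact h.k_pow _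
  unfold kern
  rw [e0, e1, e2, e3, ← add_assoc, ← add_assoc, qPoch_succ (k / a), qPoch_succ k,
    qPoch_succ (q * k), qPoch_succ (q * k / z), qPoch_succ q q m, qPoch_succ (a * q), pow_succ]
  have d1 := h.one_sub_k
  have d2 := qPoch_ne_zero h.qk_pow (j + m)
  have d3 := qPoch_ne_zero h.qkz_pow (j + m)
  have d4 := qPoch_ne_zero h.q_pow m
  have d5 := qPoch_ne_zero h.aq_pow (2 * j + m)
  have d6 := h.qk_pow (j + m)
  have d7 := h.qkz_pow (j + m)
  have d8 := h.q_pow m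
  have d9 := h.aq_pow (2 * j + m)
  rw [div_mul_div_comm, div_eq_div_iff]
  · ring
  · positivity
  · positivity

set_option maxHeartbeats 1000000 in
-- The shift leaves `k / a` fixed and moves every other base point affected by one factor `q`, so
-- the quotient is rational in the powers of `q`.
lemma kern_shift (h : Admissible q a k z) (j m : ℕ) :
    kern q (a * q) (k * q) z j m = kern q a k z j m *
      (q ^ m * (1 - k * q * (q ^ (j + m)) ^ 2) * (1 - k * q ^ (2 * j + m)) *
        (1 - q * a * q ^ j) * (1 - q * a / z * q ^ j) * (1 - q * k / z) /
      ((1 - k * (q ^ (j + m)) ^ 2) * (1 - q * a / z) * (1 - q * k * q ^ (j + m)) *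
        (1 - q * k / z * q ^ (j + m)) * (1 - a * q * q ^ (2 * j + m)))) := by
  have sh : ∀ {x : ℂ} (n : ℕ), 1 - x ≠ 0 →
      qPoch (x * q) q n = qPoch x q n * (1 - x * q ^ n) / (1 - x) := by
    intro x n hx
    rw [← qPoch_shift, mul_div_cancel_left₀ _ hx]
  have z0 : ∀ {x : ℂ}, (∀ i : ℕ, 1 - x * q ^ i ≠ 0) → 1 - x ≠ 0 := fun hx => by
    simpa using hx 0
  have e3 : 1 - k * q ^ (2 * (j + m)) = 1 - k * (q ^ (j + m)) ^ 2 := by ring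
  have e4 : 1 - k * q * q ^ (2 * (j + m)) = 1 - k * q * (q ^ (j + m)) ^ 2 := by ring
  have d0 : 1 - k * (q ^ (j + m)) ^ 2 ≠ 0 := by rw [← e3]; exact h.k_pow _
  have d1 := h.one_sub_k
  have d2 := qPoch_ne_zero h.qk_pow (j + m)
  have d3 := qPoch_ne_zero h.qkz_pow (j + m)
  have d4 := qPoch_ne_zero h.q_pow m
  have d5 := qPoch_ne_zero h.aq_pow (2 * j + m)
  have d6 := h.qk_pow (j + m)
  have d7 := h.qkz_pow (j + m)
  have d9 := h.aq_pow (2 * j + m)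
  have c1 := z0 h.qa_pow
  have c2 := z0 h.qaz_pow
  have c3 := z0 h.qk_pow
  have c4 := z0 h.qkz_pow
  have c5 := z0 h.aq_pow
  have hka : k * q / (a * q) = k / a := mul_div_mul_right _ _ h.q_ne
  have hr : (q * (a * q) / z) ^ m = (q * a / z) ^ m * q ^ m := by
    rw [← mul_pow]; ring
  unfold kern
  rw [e3, e4, hka, hr, show q * (a * q) = q * a * q by ring, show q * (k * q) = q * k * q by ring,
    mul_div_right_comm (q * a), mul_div_right_comm (q * k), sh _ c1, sh _ c2, sh _ c3, sh _ c4,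
    sh _ c5, sh _ d1]
  have c6 : 1 - k * q ≠ 0 := by rw [mul_comm k q]; exact c3
  have c7 : (1 : ℂ) - q * a = 1 - a * q := by ring
  have c8 : (1 : ℂ) - q * k = 1 - k * q := by ring
  rw [c7, c8]
  -- With every factor made an opaque atom, only cancellation remains.
  clear sh z0 hka hr e3 e4 c7 c8
  generalize qPoch (q * k) q (j + m) = p2 at *
  generalize qPoch (q * k / z) q (j + m) = p3 at *
  generalize qPoch q q m = p4 at *
  generalize qPoch (a * q) q (2 * j + m) = p5 at *
  generalize qPoch (q * a) q j = p6 at *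
  generalize qPoch (q * a / z) q j = p7 at *
  generalize qPoch k q (2 * j + m) = p8 at *
  generalize qPoch (k / a) q m = p9 at *
  generalize qPoch (z * q ^ j) q m = p10 at *
  generalize qPoch q q (j + m - 1) = p11 at *
  generalize 1 - k * q * (q ^ (j + m)) ^ 2 = x1 at *
  generalize 1 - q * k * q ^ (j + m) = x2 at *
  generalize 1 - q * k / z * q ^ (j + m) = x3 at *
  generalize 1 - a * q * q ^ (2 * j + m) = x4 at *
  generalize 1 - q * a / z = x5 at *
  generalize 1 - q * k / z = x6 at *
  generalize 1 - k * (q ^ (j + m)) ^ 2 = x7 at *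
  generalize 1 - q * a / z * q ^ j = x8 at *
  generalize 1 - q * a * q ^ j = x9 at *
  generalize 1 - k * q ^ (2 * j + m) = x10 at *
  generalize (q * a / z) ^ m = x11 at *
  generalize q ^ m = x12 at *
  generalize 1 - k = x13 at *
  generalize 1 - a * q = x14 at *
  generalize 1 - k * q = x15 at *
  field_simp

/-- The antidifference that telescopes `kern q a k z - kern q (a * q) (k * q) z`. -/
def kernAnti (q a k z : ℂ) (j m : ℕ) : ℂ :=
  -(kern q a k z j m * ((1 - q ^ m) * (1 - q * a / z * k * q ^ (2 * j + m)) /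
    ((1 - q * a / z) * (1 - k * (q ^ (j + m)) ^ 2))))

/-- By `kern_shift` and `kern_succ` all four terms are rational multiples of `kern q a k z j m`;
what is left is the identity `key`, in the manner of Wilf and Zeilberger. -/
lemma kern_sub_kern_shift (h : Admissible q a k z) (j m : ℕ) (hjm : 1 ≤ j + m) :
    kern q a k z j m - kern q (a * q) (k * q) z j m =
      kernAnti q a k z j (m + 1) - kernAnti q a k z j m := by
  unfold kernAnti
  rw [kern_shift h, kern_succ h j m hjm]
  have d0 : 1 - k * (q ^ (j + m)) ^ 2 ≠ 0 := by
    rw [← pow_mul]; exact h.k_pow _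
  have d1 : 1 - k * (q ^ (j + (m + 1))) ^ 2 ≠ 0 := by
    rw [← pow_mul]; exact h.k_pow _
  have d6 := h.qk_pow (j + m)
  have d7 := h.qkz_pow (j + m)
  have d8 := h.q_pow m
  have d9 := h.aq_pow (2 * j + m)
  have c2 : 1 - q * a / z ≠ 0 := by simpa using h.qaz_pow 0
  have e1 : 1 - k * q ^ 2 * (q ^ (j + m)) ^ 2 = 1 - k * (q ^ (j + (m + 1))) ^ 2 := by ring
  have e2 : (1 - z * q ^ (j + m)) * (q * a / z) = q * a * (1 / z - q ^ (j + m)) := by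
    have := h.z_ne
    field_simp
  have e3 : 1 - q ^ (m + 1) = 1 - q * q ^ m := by ring
  have key : (1 - k * (q ^ (j + m)) ^ 2) * (1 - q * a / z) * (1 - q * k * q ^ (j + m)) *
        (1 - q * k / z * q ^ (j + m)) * (1 - a * q * q ^ (2 * j + m)) -
      q ^ m * (1 - k * q * (q ^ (j + m)) ^ 2) * (1 - k * q ^ (2 * j + m)) *
        (1 - q * a * q ^ j) * (1 - q * a / z * q ^ j) * (1 - q * k / z) =
      -(((1 - z * q ^ (j + m)) * (q * a / z)) * (1 - q ^ (j + m)) *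
        (1 - k / a * q ^ m) * (1 - k * q ^ (2 * j + m)) *
        (1 - q * a / z * k * q ^ (2 * j + (m + 1)))) +
      (1 - q ^ m) * (1 - q * a / z * k * q ^ (2 * j + m)) *
        ((1 - q * k * q ^ (j + m)) * (1 - q * k / z * q ^ (j + m)) *
          (1 - a * q * q ^ (2 * j + m))) := by
    -- With `d = k / a` the identity becomes polynomial in `d`, `a`, `z⁻¹` and powers of `q`, once
    -- `z` has been absorbed by `e2`.
    obtain ⟨d, rfl⟩ : ∃ d, k = d * a := ⟨k / a, (div_mul_cancel₀ _ h.a_ne).symm⟩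
    rw [e2, mul_div_cancel_right₀ _ h.a_ne]
    simp only [div_eq_mul_inv, pow_add, pow_mul']
    ring
  rw [e1, e3]
  generalize 1 - k * (q ^ (j + (m + 1))) ^ 2 = x1 at *
  generalize 1 - q * k * q ^ (j + m) = x2 at *
  generalize 1 - q * k / z * q ^ (j + m) = x3 at *
  generalize 1 - a * q * q ^ (2 * j + m) = x4 at *
  generalize 1 - k * (q ^ (j + m)) ^ 2 = x5 at *
  generalize 1 - q * q ^ m = x6 at *
  generalize 1 - k * q * (q ^ (j + m)) ^ 2 = y1 at *
  generalize 1 - k * q ^ (2 * j + m) = y2 at *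
  generalize 1 - q * a * q ^ j = y3 at *
  generalize 1 - q * a / z * q ^ j = y4 at *
  generalize 1 - q * k / z = y5 at *
  generalize 1 - q * a / z * k * q ^ (2 * j + (m + 1)) = y6 at *
  generalize 1 - q * a / z * k * q ^ (2 * j + m) = y7 at *
  generalize 1 - q * a / z = x7 at *
  generalize q * a / z = r at *
  generalize 1 - z * q ^ (j + m) = y8 at *
  generalize 1 - k / a * q ^ m = y9 at *
  generalize 1 - q ^ (j + m) = y10 at *
  generalize 1 - q ^ m = y11 at *
  generalize kern q a k z j m = E
  clear e1 e2 e3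
  field_simp
  linear_combination E * key

end

/-! ### Summation of the kernel over `m`. -/

section

variable {q a k z : ℂ}

/-- All factors but `(qa/z)^m` are bounded. Uniformity in `N` serves the limit along the shifts,
uniformity in `j` the interchange of summations. -/
lemma exists_norm_kern_le (h : Admissible q a k z) :
    ∃ C : ℝ, 0 < C ∧ ∀ N j m : ℕ,
      ‖kern q (a * q ^ N) (k * q ^ N) z j m‖ ≤ C * ‖q * a / z‖ ^ m := by
  have hq := h.norm_lt
  obtain ⟨C1, h1, b1⟩ := exists_norm_qPoch_le hq z
  obtain ⟨C2, h2, b2⟩ := exists_norm_qPoch_le hq q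
  obtain ⟨C3, h3, b3⟩ := exists_norm_qPoch_le hq (q * a)
  obtain ⟨C4, h4, b4⟩ := exists_norm_qPoch_le hq (q * a / z)
  obtain ⟨C5, h5, b5⟩ := exists_norm_qPoch_le hq (k / a)
  obtain ⟨C6, h6, b6⟩ := exists_norm_qPoch_le hq k
  obtain ⟨D1, g1, e1⟩ := exists_norm_inv_qPoch_le hq h.k_pow
  obtain ⟨D2, g2, e2⟩ := exists_norm_inv_qPoch_le hq h.qk_pow
  obtain ⟨D3, g3, e3⟩ := exists_norm_inv_qPoch_le hq h.qkz_pow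
  obtain ⟨D4, g4, e4⟩ := exists_norm_inv_qPoch_le hq h.q_pow
  obtain ⟨D5, g5, e5⟩ := exists_norm_inv_qPoch_le hq h.aq_pow
  refine ⟨(1 + ‖k‖) * C1 * C2 * (C3 * C4) * (C5 * C6) * (D1 * (D2 * D3) * (D4 * D5)),
    by positivity, fun N j m => ?_⟩
  have hka : k * q ^ N / (a * q ^ N) = k / a := mul_div_mul_right _ _ (pow_ne_zero _ h.q_ne)
  have hpow : ∀ n : ℕ, ‖q‖ ^ n ≤ 1 := fun n => pow_le_one₀ (norm_nonneg _) hq.le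
  have f1 : ‖1 - k * q ^ N * q ^ (2 * (j + m))‖ ≤ 1 + ‖k‖ := by
    refine (norm_sub_le _ _).trans ?_
    rw [norm_one, mul_assoc, ← pow_add, norm_mul, norm_pow]
    have := mul_le_mul_of_nonneg_left (hpow (N + 2 * (j + m))) (norm_nonneg k)
    linarith
  have f2 : ‖(q * (a * q ^ N) / z) ^ m‖ ≤ ‖q * a / z‖ ^ m := by
    rw [norm_pow]
    refine pow_le_pow_left₀ (norm_nonneg _) ?_ _
    rw [show q * (a * q ^ N) / z = q * a / z * q ^ N by ring, norm_mul, norm_pow]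
    exact mul_le_of_le_one_right (norm_nonneg _) (hpow N)
  have b2' : ‖qPoch q q (j + m - 1)‖ ≤ C2 := by simpa using b2 0 (j + m - 1)
  have b5' : ‖qPoch (k / a) q m‖ ≤ C5 := by simpa using b5 0 m
  have e4' : ‖(qPoch q q m)⁻¹‖ ≤ D4 := by simpa using e4 0 m
  have e1' : ‖(1 - k * q ^ N)⁻¹‖ ≤ D1 := by simpa [qPoch] using e1 N 1
  unfold kern
  rw [hka, show q * (a * q ^ N) / z = q * a / z * q ^ N by ring, ← mul_assoc q a,
    show q * (k * q ^ N) / z = q * k / z * q ^ N by ring, ← mul_assoc q k,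
    mul_right_comm a, div_eq_mul_inv]
  rw [show q * (a * q ^ N) / z = q * a / z * q ^ N by ring] at f2
  simp only [mul_inv]
  calc _ ≤ (1 + ‖k‖) * C1 * C2 * (C3 * C4) * (C5 * C6) * ‖q * a / z‖ ^ m *
        (D1 * (D2 * D3) * (D4 * D5)) := by
        have i1 := norm_mul_le_of_le (norm_mul_le_of_le f1 (b1 j m)) b2'
        have i2 := norm_mul_le_of_le (b3 N j) (b4 N j)
        have i3 := norm_mul_le_of_le b5' (b6 N (2 * j + m))
        have i4 := norm_mul_le_of_le (e2 N (j + m)) (e3 N (j + m))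
        have i5 := norm_mul_le_of_le e4' (e5 N (2 * j + m))
        exact norm_mul_le_of_le (norm_mul_le_of_le (norm_mul_le_of_le (norm_mul_le_of_le i1 i2) i3)
          f2) (norm_mul_le_of_le (norm_mul_le_of_le e1' i4) i5)
    _ = _ := by ring

lemma tendsto_kern (h : Admissible q a k z) (j m : ℕ) :
    Tendsto (fun N : ℕ => kern q (a * q ^ N) (k * q ^ N) z j m) atTop
      (𝓝 (if m = 0 then qPoch q q (j - 1) else 0)) := by
  -- The shifted kernel with `y` in place of `q^N`; it is continuous at `y = 0`, where the factor
  -- `(qay/z)^m` kills every `m > 0`.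
  let φ : ℂ → ℂ := fun y =>
    (1 - k * y * q ^ (2 * (j + m))) * qPoch (z * q ^ j) q m * qPoch q q (j + m - 1) *
      (qPoch (q * (a * y)) q j * qPoch (q * (a * y) / z) q j) *
      (qPoch (k / a) q m * qPoch (k * y) q (2 * j + m)) * (q * (a * y) / z) ^ m /
    ((1 - k * y) * (qPoch (q * (k * y)) q (j + m) * qPoch (q * (k * y) / z) q (j + m)) *
      (qPoch q q m * qPoch (a * y * q) q (2 * j + m)))
  have hp0 : ∀ n, qPoch 0 q n = 1 := fun n => by simp [qPoch]
  have hqm := qPoch_ne_zero h.q_pow m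
  have hc : ∀ {g : ℂ → ℂ} (n : ℕ), Continuous g → Continuous fun y => qPoch (g y) q n :=
    fun n hg => (continuous_qPoch q n).comp hg
  have hφ : ContinuousAt φ 0 := by
    refine ContinuousAt.div (Continuous.continuousAt ?_) (Continuous.continuousAt ?_) ?_
    · have c1 := hc j (g := fun y => q * (a * y)) (by fun_prop)
      have c2 := hc j (g := fun y => q * (a * y) / z) (by fun_prop)
      have c3 := hc (2 * j + m) (g := fun y => k * y) (by fun_prop)
      fun_prop
    · have c1 := hc (j + m) (g := fun y => q * (k * y)) (by fun_prop)
      have c2 := hc (j + m) (g := fun y => q * (k * y) / z) (by fun_prop)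
      have c3 := hc (2 * j + m) (g := fun y => a * y * q) (by fun_prop)
      fun_prop
    · simp [hp0, hqm]
  have hφ0 : φ 0 = if m = 0 then qPoch q q (j - 1) else 0 := by
    by_cases hm : m = 0
    · subst hm; simp [φ, hp0, qPoch_zero]
    · simp [φ, hm]
  rw [← hφ0]
  refine (hφ.tendsto.comp (tendsto_pow_atTop_nhds_zero_of_norm_lt_one h.norm_lt)).congr fun N => ?_
  have hka : k * q ^ N / (a * q ^ N) = k / a := mul_div_mul_right _ _ (pow_ne_zero _ h.q_ne)
  simp only [φ, kern, Function.comp, hka]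

lemma summable_kern (h : Admissible q a k z) (hr : ‖q * a / z‖ < 1) (N j : ℕ) :
    Summable fun m => kern q (a * q ^ N) (k * q ^ N) z j m := by
  obtain ⟨C, -, hC⟩ := exists_norm_kern_le h
  exact Summable.of_norm_bounded
    ((summable_geometric_of_lt_one (norm_nonneg _) hr).mul_left C) fun m => hC N j m

lemma Admissible.norm_shift_lt (h : Admissible q a k z) (hr : ‖q * a / z‖ < 1) (N : ℕ) :
    ‖q * (a * q ^ N) / z‖ < 1 := by
  rw [show q * (a * q ^ N) / z = q * a / z * q ^ N by ring, norm_mul, norm_pow]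
  exact lt_of_le_of_lt (mul_le_of_le_one_right (norm_nonneg _)
    (pow_le_one₀ (norm_nonneg _) h.norm_lt.le)) hr

lemma tendsto_kernAnti (h : Admissible q a k z) (hr : ‖q * a / z‖ < 1) (j : ℕ) :
    Tendsto (fun m => kernAnti q a k z j m) atTop (𝓝 0) := by
  have hs := (summable_kern h hr 0 j).tendsto_atTop_zero
  simp only [pow_zero, mul_one] at hs
  have hq := tendsto_pow_atTop_nhds_zero_of_norm_lt_one h.norm_lt
  have hq1 : Tendsto (fun m => q ^ (2 * j + m)) atTop (𝓝 0) := by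
    simp_rw [pow_add]; simpa using hq.const_mul (q ^ (2 * j))
  have hq2 : Tendsto (fun m => q ^ (j + m)) atTop (𝓝 0) := by
    simp_rw [pow_add]; simpa using hq.const_mul (q ^ j)
  have c2 : 1 - q * a / z ≠ 0 := by simpa using h.qaz_pow 0
  have n1 : Tendsto (fun m => (1 - q ^ m) * (1 - q * a / z * k * q ^ (2 * j + m))) atTop
      (𝓝 ((1 - 0) * (1 - q * a / z * k * 0))) := 
    (hq.const_sub 1).mul ((hq1.const_mul _).const_sub 1)
  have n2 : Tendsto (fun m => (1 - q * a / z) * (1 - k * (q ^ (j + m)) ^ 2)) atTop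
      (𝓝 ((1 - q * a / z) * (1 - k * 0 ^ 2))) := 
    (((hq2.pow 2).const_mul k).const_sub 1).const_mul _
  have := (hs.mul (n1.div n2 (by simpa using c2))).neg
  rw [zero_mul, neg_zero] at this
  exact this

lemma tsum_sub_tsum_of_telescope {f g G : ℕ → ℂ} (hf : Summable f) (hg : Summable g)
    (hG : Tendsto G atTop (𝓝 0)) (h : ∀ m, f m - g m = G (m + 1) - G m) :
    ∑' m, f m - ∑' m, g m = -G 0 := by
  rw [← hf.tsum_sub hg]
  refine tendsto_nhds_unique (hf.sub hg).hasSum.tendsto_sum_nat ?_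
  simp only [h, Finset.sum_range_sub]
  simpa using hG.sub_const (G 0)

/-- The antidifference tends to `0` at infinity and vanishes at `m = 0` through its factor `1 -
q^m`. -/
lemma tsum_kern_shift (h : Admissible q a k z) (hr : ‖q * a / z‖ < 1) {j : ℕ} (hj : 1 ≤ j) :
    ∑' m, kern q a k z j m = ∑' m, kern q (a * q) (k * q) z j m := by
  rw [← sub_eq_zero]
  have h0 := summable_kern h hr 0 j
  have h1 := summable_kern h hr 1 j
  simp only [pow_zero, mul_one, pow_one] at h0 h1
  rw [tsum_sub_tsum_of_telescope h0 h1 (tendsto_kernAnti h hr j)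
    fun m => kern_sub_kern_shift h j m (by omega)]
  simp [kernAnti]

/-- A case of the nonterminating `₆φ₅` summation. -/
lemma tsum_kern (h : Admissible q a k z) (hr : ‖q * a / z‖ < 1) {j : ℕ} (hj : 1 ≤ j) :
    ∑' m, kern q a k z j m = qPoch q q (j - 1) := by
  -- The sum is invariant under the shift, so it equals its limit as `N → ∞`, where only `m = 0`
  -- contributes.
  have hconst : ∀ N : ℕ,
      ∑' m, kern q (a * q ^ N) (k * q ^ N) z j m = ∑' m, kern q a k z j m := by
    intro N
    induction N with
    | zero => simp
    | succ N ih =>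
      rw [← ih, tsum_kern_shift (h.shift N) (h.norm_shift_lt hr N) hj]
      simp only [pow_succ, mul_assoc]
  obtain ⟨C, -, hC⟩ := exists_norm_kern_le h
  have hlim := tendsto_tsum_of_dominated_convergence
    ((summable_geometric_of_lt_one (norm_nonneg _) hr).mul_left C)
    (fun m => tendsto_kern h j m) (Eventually.of_forall fun N m => hC N j m)
  simp only [hconst] at hlim
  rw [tendsto_nhds_unique tendsto_const_nhds hlim]
  exact tsum_ite_eq 0 _

/-- The Lambert series `∑_{i ≥ 0} x q^i / (1 - x q^i)`. -/
def lambert (x q : ℂ) : ℂ := ∑' i : ℕ, x * q ^ i / (1 - x * q ^ i)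

lemma summable_lambert {x : ℂ} (hq : ‖q‖ < 1) (h : ∀ i : ℕ, 1 - x * q ^ i ≠ 0) :
    Summable fun i : ℕ => x * q ^ i / (1 - x * q ^ i) := by
  obtain ⟨C, -, hC⟩ := exists_norm_inv_qPoch_le hq h
  refine Summable.of_norm_bounded ((summable_norm_mul_pow hq x).mul_right C) fun i => ?_
  rw [div_eq_mul_inv, norm_mul]
  have := hC i 1
  simp only [qPoch, Finset.range_one, Finset.prod_singleton, pow_zero, mul_one] at this
  exact mul_le_mul_of_nonneg_left this (norm_nonneg _)

/-- A partial fraction expansion with `w = 1/z` and `d = k/a`; the left side is `-kernAnti q a k z 0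
1`. -/
lemma telescope_boundary_eq (d w : ℂ) (hw : z * w = 1) (d1 : 1 - q * (d * a) ≠ 0)
    (d2 : 1 - q * a ≠ 0) (d3 : 1 - q * a * w ≠ 0) (d4 : 1 - q * (d * a) * w ≠ 0) :
    (1 - z) * (1 - d) * (q * a * w) * (1 - q * a * w * (d * a) * q) / ((1 - q * (d * a)) *
    (1 - q * (d * a) * w) * (1 - q * a) * (1 - q * a * w)) =
    q * (d * a) / (1 - q * (d * a)) - q * a / (1 - q * a) + q * a * w / (1 - q * a * w) -
        q * (d * a) * w / (1 - q * (d * a) * w) := by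
  have e1 : ∀ x : ℂ, 1 - x ≠ 0 → x / (1 - x) = 1 / (1 - x) - 1 := by
    intro x hx; field_simp; ring
  rw [e1 _ d1, e1 _ d2, e1 _ d3, e1 _ d4, div_eq_iff (by simp [*])]
  have : (1 - z) * (1 - d) * (q * a * w) = (w - 1) * (1 - d) * (q * a) := by
    linear_combination -(1 - d) * q * a * hw
  rw [this]
  generalize hA : 1 - q * (d * a) = A at *
  generalize hB : 1 - q * (d * a) * w = B at *
  generalize hC : 1 - q * a = C at *
  generalize hD : 1 - q * a * w = D at *
  field_simp
  subst hA hB hC hD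
  ring

/-- For `j = 0` the telescoping starts at `m = 1`, so a nonzero boundary term survives; it consists
of the leading terms of four Lambert series. -/
lemma tsum_kern_zero_sub_shift (h : Admissible q a k z) (hr : ‖q * a / z‖ < 1) :
    ∑' m, kern q a k z 0 (m + 1) - ∑' m, kern q (a * q) (k * q) z 0 (m + 1) =
      q * k / (1 - q * k) - q * a / (1 - q * a) + q * a / z / (1 - q * a / z) -
        q * k / z / (1 - q * k / z) := by
  have h0 := summable_kern h hr 0 0
  have h1 := summable_kern h hr 1 0
  simp only [pow_zero, mul_one, pow_one] at h0 h1
  rw [tsum_sub_tsum_of_telescope ((summable_nat_add_iff 1).mpr h0)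
    ((summable_nat_add_iff 1).mpr h1) ((tendsto_add_atTop_iff_nat 1).mpr (tendsto_kernAnti h hr 0))
    fun m => kern_sub_kern_shift h 0 (m + 1) (by omega)]
  have d1 : 1 - q * k ≠ 0 := by simpa using h.qk_pow 0
  have d2 : 1 - q * a ≠ 0 := by simpa using h.qa_pow 0
  have d3 : 1 - q * a / z ≠ 0 := by simpa using h.qaz_pow 0
  have d4 : 1 - q * k / z ≠ 0 := by simpa using h.qkz_pow 0
  have d5 : 1 - q ≠ 0 := by simpa using h.q_pow 0
  have d6 := h.one_sub_k
  have d7 : 1 - k * q ^ 2 ≠ 0 := h.k_pow 2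
  have hz := h.z_ne
  have ha := h.a_ne
  obtain ⟨d, rfl⟩ : ∃ d, k = d * a := ⟨k / a, (div_mul_cancel₀ _ ha).symm⟩
  have e2 : 1 - a * q = 1 - q * a := by ring
  have key := telescope_boundary_eq (q := q) (a := a) d z⁻¹ (mul_inv_cancel₀ hz) d1 d2 d3 d4
  simp only [← div_eq_mul_inv] at key
  rw [← key]
  simp only [kernAnti, kern, qPoch, zero_add, Finset.range_one, Finset.prod_singleton, pow_zero,
    mul_one, pow_one, Nat.sub_self, Finset.range_zero, Finset.prod_empty, mul_zero, neg_neg, e2,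
    mul_div_cancel_right₀ _ ha]
  generalize 1 - q * (d * a) = x1 at *
  generalize 1 - q * (d * a) / z = x2 at *
  generalize 1 - q * a = x3 at *
  generalize 1 - q * a / z = x4 at *
  generalize 1 - q * a / z * (d * a) * q = x5 at *
  generalize q * a / z = x6 at *
  generalize 1 - q = x7 at *
  generalize 1 - d * a = x8 at *
  generalize 1 - d * a * q ^ 2 = x9 at *
  field_simp

lemma tsum_kern_zero (h : Admissible q a k z) (hr : ‖q * a / z‖ < 1) :
    ∑' m, kern q a k z 0 (m + 1) =
      lambert (q * k) q - lambert (q * a) q + lambert (q * a / z) q - lambert (q * k / z) q := by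
  have hq := h.norm_lt
  let f : ℕ → ℂ := fun i => q * k * q ^ i / (1 - q * k * q ^ i) -
    q * a * q ^ i / (1 - q * a * q ^ i) + q * a / z * q ^ i / (1 - q * a / z * q ^ i) -
    q * k / z * q ^ i / (1 - q * k / z * q ^ i)
  have hf : HasSum f (lambert (q * k) q - lambert (q * a) q + lambert (q * a / z) q -
      lambert (q * k / z) q) :=
    (((summable_lambert hq h.qk_pow).hasSum.sub (summable_lambert hq h.qa_pow).hasSum).add
      (summable_lambert hq h.qaz_pow).hasSum).sub (summable_lambert hq h.qkz_pow).hasSum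
  -- Each shift removes one more term of the Lambert series; the remaining sum tends to `0`.
  have hstep : ∀ N : ℕ, ∑' m, kern q (a * q ^ N) (k * q ^ N) z 0 (m + 1) =
      ∑' m, kern q a k z 0 (m + 1) - ∑ i ∈ Finset.range N, f i := by
    intro N
    induction N with
    | zero => simp
    | succ N ih =>
      have := tsum_kern_zero_sub_shift (h.shift N) (h.norm_shift_lt hr N)
      rw [Finset.sum_range_succ, ← sub_sub, ← ih, eq_sub_iff_add_eq, ← eq_sub_iff_add_eq']
      simp only [pow_succ, ← mul_assoc]
      rw [this]
      simp only [f]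
      ring_nf
  obtain ⟨C, -, hC⟩ := exists_norm_kern_le h
  have hlim := tendsto_tsum_of_dominated_convergence (f := fun N m =>
      kern q (a * q ^ N) (k * q ^ N) z 0 (m + 1)) (g := fun _ => 0)
    ((summable_nat_add_iff 1).mpr
      ((summable_geometric_of_lt_one (norm_nonneg _) hr).mul_left C))
    (fun m => by simpa using tendsto_kern h 0 (m + 1))
    (Eventually.of_forall fun N m => hC N 0 (m + 1))
  rw [tsum_zero] at hlim
  simp only [hstep] at hlim
  exact sub_eq_zero.mp (tendsto_nhds_unique
    (tendsto_const_nhds.sub hf.tendsto_sum_nat) hlim)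

end

/-! ### Interchange of summations under conditional convergence. -/

/-- Rows `n` are regrouped into columns `j`. Column `0` loses its entry `m = 0` because `n` starts
at `1`. -/
lemma sum_Icc_triangle (u : ℕ → ℕ → ℂ) (N : ℕ) :
    ∑ n ∈ Finset.Icc 1 N, ∑ j ∈ Finset.range (n + 1), u j (n - j) =
      ∑ m ∈ Finset.range N, u 0 (m + 1) +
        ∑ j ∈ Finset.Icc 1 N, ∑ m ∈ Finset.range (N - j + 1), u j m := by
  induction N with
  | zero => simp
  | succ N ih =>
    have h1 : ∑ j ∈ Finset.Icc 1 (N + 1), ∑ m ∈ Finset.range (N + 1 - j + 1), u j m =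
        ∑ j ∈ Finset.Icc 1 N, ∑ m ∈ Finset.range (N - j + 1), u j m +
          ∑ j ∈ Finset.Icc 1 (N + 1), u j (N + 1 - j) := by
      rw [Finset.sum_Icc_succ_top (by omega), Finset.sum_Icc_succ_top (by omega), ← add_assoc,
        ← Finset.sum_add_distrib]
      congr 1
      · refine Finset.sum_congr rfl fun j hj => ?_
        rw [Finset.mem_Icc] at hj
        rw [Finset.sum_range_succ, show N + 1 - j = N - j + 1 by omega]
      · simp
    rw [Finset.sum_Icc_succ_top (by omega), ih, h1, Finset.sum_range_succ _ N,
      Finset.sum_range_succ' _ (N + 1)]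
    have h2 : ∑ j ∈ Finset.Icc 1 (N + 1), u j (N + 1 - j) =
        ∑ i ∈ Finset.range (N + 1), u (i + 1) (N + 1 - (i + 1)) := by
      rw [Finset.range_eq_Ico, Finset.sum_Ico_add' (fun i => u i (N + 1 - i)) 0 (N + 1) 1]
      rfl
    rw [h2, Nat.sub_zero]
    ring

/-- A null sequence convolved with a geometrically bounded one is null: reverse by `m = N - j` and
use dominated convergence. -/
lemma tendsto_sum_Icc_mul_of_geometric {V : ℕ → ℂ} {E : ℕ → ℕ → ℂ} {C r : ℝ} (hr0 : 0 ≤ r)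
    (hr : r < 1) (hV : Tendsto V atTop (𝓝 0)) (hE : ∀ j m, ‖E j m‖ ≤ C * r ^ m) :
    Tendsto (fun N : ℕ => ∑ j ∈ Finset.Icc 1 N, V j * E j (N - j)) atTop (𝓝 0) := by
  obtain ⟨D, hD, hVD⟩ := (Metric.isBounded_range_of_tendsto _ hV).exists_pos_norm_le
  have hC : 0 ≤ C := by simpa using (norm_nonneg _).trans (hE 0 0)
  let F : ℕ → ℕ → ℂ := fun N m => if m < N then V (N - m) * E (N - m) m else 0
  have hbound : ∀ N m, ‖F N m‖ ≤ D * (C * r ^ m) := by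
    intro N m
    by_cases hm : m < N
    · simp only [F, if_pos hm]
      exact norm_mul_le_of_le (hVD _ ⟨_, rfl⟩) (hE _ _)
    · simp only [F, if_neg hm, norm_zero]; positivity
  have hpt : ∀ m, Tendsto (fun N => F N m) atTop (𝓝 0) := by
    intro m
    have h1 : Tendsto (fun N => ‖V (N - m)‖ * (C * r ^ m)) atTop (𝓝 0) := by
      simpa using ((hV.comp (tendsto_sub_atTop_nat m)).norm).mul_const (C * r ^ m)
    refine squeeze_zero_norm (fun N => ?_) h1
    by_cases hm : m < N
    · simp only [F, if_pos hm]
      exact norm_mul_le_of_le le_rfl (hE _ _)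
    · simp only [F, if_neg hm, norm_zero]; positivity
  have hlim := tendsto_tsum_of_dominated_convergence
    (((summable_geometric_of_lt_one hr0 hr).mul_left C).mul_left D) hpt
    (Eventually.of_forall hbound)
  rw [tsum_zero] at hlim
  refine hlim.congr fun N => ?_
  rw [tsum_eq_sum (s := Finset.range N)
    (fun m hm => if_neg (by simpa using hm))]
  refine Finset.sum_bij' (fun m _ => N - m) (fun j _ => N - j) ?_ ?_ ?_ ?_ ?_
  · intro m hm; rw [Finset.mem_range] at hm; rw [Finset.mem_Icc]; omega
  · intro m hm; rw [Finset.mem_Icc] at hm; rw [Finset.mem_range]; omega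
  · intro m hm; rw [Finset.mem_range] at hm; omega
  · intro m hm; rw [Finset.mem_Icc] at hm; omega
  · intro m hm; rw [Finset.mem_range] at hm
    rw [if_pos hm, show N - (N - m) = m by omega]

/-- Summation of a triangular double series whose first-index series converges only
conditionally. -/
lemma tendsto_sum_triangle {V s : ℕ → ℂ} {e : ℕ → ℕ → ℂ} {C r : ℝ} {A f : ℂ} (hr0 : 0 ≤ r)
    (hr : r < 1) (hV : Tendsto V atTop (𝓝 0)) (he : ∀ j m, ‖e j m‖ ≤ C * r ^ m)
    (hs : ∀ j, 1 ≤ j → HasSum (e j) (s j)) (hf : HasSum (fun m => e 0 (m + 1)) f)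
    (hA : SeriesHasSum (fun j => V j * s j) A) :
    SeriesHasSum (fun n => ∑ j ∈ Finset.range (n + 1), V j * e j (n - j)) (V 0 * f + A) := by
  unfold SeriesHasSum at *
  -- Minus the tail of column `j`, geometrically small. It is set to `0` for `j = 0`, since that
  -- column is summed separately to `f`.
  let E : ℕ → ℕ → ℂ := fun j M =>
    if 1 ≤ j then ∑ m ∈ Finset.range (M + 1), e j m - s j else 0
  have hC : 0 ≤ C := by simpa using (norm_nonneg _).trans (he 0 0)
  have h1r : 0 < 1 - r := by linarith
  have hE : ∀ j M, ‖E j M‖ ≤ C * r / (1 - r) * r ^ M := by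
    intro j M
    by_cases hj : 1 ≤ j
    · simp only [E, if_pos hj]
      refine (norm_sub_le_of_geometric_bound_of_hasSum hr (he j) (hs j hj) (M + 1)).trans_eq ?_
      rw [pow_succ]; ring
    · simp only [E, if_neg hj, norm_zero]; positivity
  have h0 := tendsto_sum_Icc_mul_of_geometric hr0 hr hV hE
  have := ((hf.tendsto_sum_nat.const_mul (V 0)).add hA).add h0
  rw [add_zero] at this
  refine this.congr fun N => ?_
  rw [sum_Icc_triangle (fun j m => V j * e j m), Finset.mul_sum, add_assoc,
    ← Finset.sum_add_distrib]
  congr 1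
  refine Finset.sum_congr rfl fun j hj => ?_
  rw [Finset.mem_Icc] at hj
  simp only [E, if_pos hj.1, ← Finset.mul_sum]
  ring

/-! ### The `β`-series in terms of the `α`-series. -/

section

variable {q a k z : ℂ}

/-- Apply `qPoch_shift` at `rk` and `-rk` and multiply; only `rk ^ 2` survives, so the choice of
root is immaterial. -/
lemma veryWellPoised_ratio {rk : ℂ} (hrk : rk ^ 2 = k) (h : ∀ i : ℕ, 1 - k * q ^ i ≠ 0) (n : ℕ) :
    qPoch (q * rk) q n * qPoch (-q * rk) q n / (qPoch rk q n * qPoch (-rk) q n) =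
      (1 - k * q ^ (2 * n)) / (1 - k) := by
  have hne : ∀ i : ℕ, (1 - rk * q ^ i) * (1 - -rk * q ^ i) ≠ 0 := by
    intro i
    rw [show (1 - rk * q ^ i) * (1 - -rk * q ^ i) = 1 - k * q ^ (2 * i) by rw [← hrk]; ring]
    exact h _
  have h1 := qPoch_ne_zero (fun i => left_ne_zero_of_mul (hne i)) n
  have h2 := qPoch_ne_zero (fun i => right_ne_zero_of_mul (hne i)) n
  have h3 : 1 - k ≠ 0 := by simpa using h 0
  have s1 := qPoch_shift rk q n
  have s2 := qPoch_shift (-rk) q n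
  rw [div_eq_div_iff (mul_ne_zero h1 h2) h3, mul_comm q rk, show -q * rk = -rk * q by ring]
  calc _ = ((1 - rk) * qPoch (rk * q) q n) * ((1 - -rk) * qPoch (-rk * q) q n) := by
        rw [← hrk]; ring
    _ = _ := by rw [s1, s2, ← hrk]; ring

/-- The coefficients of the `α`-series, without the factor `(q;q)_{n-1}`. -/
def alphaCoeff (q a z : ℂ) (n : ℕ) : ℂ :=
  qPoch z q n * (q * a / z) ^ n / (qPoch (q * a) q n * qPoch (q * a / z) q n)

lemma betaCoeff_mul_eq (h : Admissible q a k z) {rk : ℂ} (hrk : rk ^ 2 = k) {n j : ℕ}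
    (hj : j ≤ n) :
    qPochs [q * rk, -q * rk, z] q n * qPoch q q (n - 1) /
        qPochs [rk, -rk, q * k, q * k / z] q n * (q * a / z) ^ n *
      ((qPoch (k / a) q (n - j) * qPoch k q (n + j)) /
        (qPoch q q (n - j) * qPoch (a * q) q (n + j))) =
      alphaCoeff q a z j * kern q a k z j (n - j) := by
  obtain ⟨m, rfl⟩ := Nat.exists_eq_add_of_le hj
  have e1 : j + m + j = 2 * j + m := by ring
  have h6 := qPoch_ne_zero h.qa_pow j
  have h7 := qPoch_ne_zero h.qaz_pow j
  rw [Nat.add_sub_cancel_left, e1]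
  have hw : qPochs [q * rk, -q * rk, z] q (j + m) * qPoch q q (j + m - 1) /
        qPochs [rk, -rk, q * k, q * k / z] q (j + m) =
      (1 - k * q ^ (2 * (j + m))) / (1 - k) * (qPoch z q (j + m) * qPoch q q (j + m - 1) /
        (qPoch (q * k) q (j + m) * qPoch (q * k / z) q (j + m))) := by
    rw [← veryWellPoised_ratio hrk h.k_pow, div_mul_div_comm]
    simp only [qPochs, List.map_cons, List.map_nil, List.prod_cons, List.prod_nil, mul_one,
      mul_assoc]
  rw [hw, qPoch_add z, alphaCoeff, kern, pow_add (q * a / z), div_mul_div_comm, div_mul_eq_mul_div,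
    div_mul_div_comm, div_mul_div_comm]
  generalize qPoch (q * a) q j = p6 at *
  generalize qPoch (q * a / z) q j = p7 at *
  rw [← mul_div_mul_left _ _ (mul_ne_zero h6 h7)]
  congr 1; ring

/-- A WP-Bailey lemma in which one of the free parameters tends to `1`. -/
theorem seriesHasSum_beta (h : Admissible q a k z) (hr : ‖q * a / z‖ < 1) {rk : ℂ}
    (hrk : rk ^ 2 = k) {α β : ℕ → ℂ} (hpair : IsWPBaileyPair q a k α β) {A : ℂ}
    (hA : SeriesHasSum (fun n => qPoch z q n * qPoch q q (n - 1) /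
        qPochs [q * a, q * a / z] q n * (q * a / z) ^ n * α n) A) :
    SeriesHasSum (fun n => qPochs [q * rk, -q * rk, z] q n * qPoch q q (n - 1) /
        qPochs [rk, -rk, q * k, q * k / z] q n * (q * a / z) ^ n * β n)
      (lambert (q * k) q - lambert (q * a) q + lambert (q * a / z) q - lambert (q * k / z) q +
        A) := by
  have hq := h.norm_lt
  let V : ℕ → ℂ := fun j => alphaCoeff q a z j * α j
  have hA' : SeriesHasSum (fun j => V j * qPoch q q (j - 1)) A := by
    refine hA.congr fun N => Finset.sum_congr rfl fun n _ => ?_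
    simp only [V, alphaCoeff, qPochs, List.map_cons, List.map_nil, List.prod_cons, List.prod_nil,
      mul_one]
    ring
  have hV0 : Tendsto (fun j => V j * qPoch q q (j - 1)) atTop (𝓝 0) := by
    have h1 := ((tendsto_add_atTop_iff_nat 1).mpr hA').sub hA'
    rw [sub_self] at h1
    rw [← tendsto_add_atTop_iff_nat 1]
    refine h1.congr fun N => ?_
    rw [Finset.sum_Icc_succ_top (by omega), add_sub_cancel_left]
  -- The terms of the convergent `α`-series tend to `0`, and the factor `(q;q)_{j-1}` has a nonzero
  -- limit.
  have hV : Tendsto V atTop (𝓝 0) := by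
    have h1 : Tendsto (fun j => qPoch q q (j - 1)) atTop (𝓝 (qPochInf q q)) :=
      (tendsto_qPoch hq q).comp (tendsto_sub_atTop_nat 1)
    have h2 := hV0.div h1 (qPochInf_ne_zero hq h.q_pow)
    rw [zero_div] at h2
    exact h2.congr fun j => mul_div_cancel_right₀ _ (qPoch_ne_zero h.q_pow _)
  obtain ⟨C, -, hC⟩ := exists_norm_kern_le h
  have hC0 : ∀ j m, ‖kern q a k z j m‖ ≤ C * ‖q * a / z‖ ^ m := by
    intro j m; simpa only [pow_zero, mul_one] using hC 0 j m
  have hsum : ∀ j, Summable (kern q a k z j) := by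
    intro j
    have := summable_kern h hr 0 j
    simp only [pow_zero, mul_one] at this
    exact this
  have hs : ∀ j, 1 ≤ j → HasSum (kern q a k z j) (qPoch q q (j - 1)) := by
    intro j hj
    rw [← tsum_kern h hr hj]
    exact (hsum j).hasSum
  have hf := ((summable_nat_add_iff 1).mpr (hsum 0)).hasSum
  rw [tsum_kern_zero h hr] at hf
  have hV1 : V 0 = 1 := by simp [V, alphaCoeff, qPoch_zero, hpair.alpha_zero]
  have key := tendsto_sum_triangle (norm_nonneg _) hr hV hC0 hs hf hA'
  rw [hV1, one_mul] at key
  refine key.congr fun N => Finset.sum_congr rfl fun n hn => ?_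
  beta_reduce
  rw [hpair.beta_eq n (by rw [Finset.mem_Icc] at hn; omega), Finset.mul_sum]
  refine Finset.sum_congr rfl fun j hj => ?_
  rw [← mul_assoc, betaCoeff_mul_eq h hrk (by rw [Finset.mem_range] at hj; omega)]
  simp only [V]
  ring

end

/-! ### Theta series and the Jacobi triple product. -/

/-- The triangular exponent `n (n - 1) / 2`. -/
def tri (n : ℤ) : ℤ := n * (n - 1) / 2

lemma two_mul_tri (n : ℤ) : 2 * tri n = n * (n - 1) :=
  Int.mul_ediv_cancel' (Int.even_mul_pred_self n).two_dvd

lemma tri_add (m n : ℤ) : tri (m + n) = tri m + tri n + m * n := by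
  have h1 := two_mul_tri (m + n)
  have h2 := two_mul_tri m
  have h3 := two_mul_tri n
  have : 2 * tri (m + n) = 2 * (tri m + tri n + m * n) := by
    rw [h1, mul_add, mul_add, h2, h3]; ring
  omega

/-- The general term `q^{n(n-1)/2} x^n` of the theta series. -/
def thetaTerm (q x : ℂ) (n : ℤ) : ℂ := q ^ tri n * x ^ n

section

variable {q x : ℂ}

lemma thetaTerm_add (hq : q ≠ 0) (hx : x ≠ 0) (m n : ℤ) :
    thetaTerm q x (m + n) = thetaTerm q x m * thetaTerm q x n * q ^ (m * n) := by
  simp only [thetaTerm, tri_add, zpow_add₀ hq, zpow_add₀ hx]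
  ring

lemma thetaTerm_one (q x : ℂ) : thetaTerm q x 1 = x := by simp [thetaTerm, tri]

lemma thetaTerm_zero (q x : ℂ) : thetaTerm q x 0 = 1 := by simp [thetaTerm, tri]

lemma thetaTerm_succ (hq : q ≠ 0) (hx : x ≠ 0) (n : ℤ) :
    thetaTerm q x (n + 1) = thetaTerm q x n * (x * q ^ n) := by
  rw [thetaTerm_add hq hx, thetaTerm_one, mul_one, mul_assoc]

lemma thetaTerm_ne_zero (hq : q ≠ 0) (hx : x ≠ 0) (n : ℤ) : thetaTerm q x n ≠ 0 :=
  mul_ne_zero (zpow_ne_zero _ hq) (zpow_ne_zero _ hx)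

lemma summable_norm_thetaTerm (hq : q ≠ 0) (hq1 : ‖q‖ < 1) (hx : x ≠ 0) :
    Summable fun n : ℤ => ‖thetaTerm q x n‖ := by
  have hlim := tendsto_pow_atTop_nhds_zero_of_norm_lt_one hq1
  -- In both directions the ratio of consecutive terms is `c * q ^ n`, which tends to `0`.
  have ratio : ∀ (f : ℕ → ℂ) (c : ℂ), (∀ n, f n ≠ 0) → (∀ n, f (n + 1) = f n * (c * q ^ n)) →
      Summable fun n => ‖f n‖ := by
    intro f c hf hrec
    refine (summable_of_ratio_test_tendsto_lt_one zero_lt_one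
      (Eventually.of_forall hf) ?_).norm
    have h1 : Tendsto (fun n : ℕ => ‖c * q ^ n‖) atTop (𝓝 0) := by
      simpa using (hlim.const_mul c).norm
    refine h1.congr fun n => ?_
    rw [hrec, norm_mul (f n), mul_div_cancel_left₀ _ (norm_ne_zero_iff.mpr (hf n))]
  refine Summable.of_nat_of_neg ?_ ?_
  · refine ratio (fun n => thetaTerm q x n) x (fun n => thetaTerm_ne_zero hq hx _) fun n => ?_
    rw [Nat.cast_succ, thetaTerm_succ hq hx, zpow_natCast]
  · refine ratio (fun n => thetaTerm q x (-n)) (q * x⁻¹) (fun n => thetaTerm_ne_zero hq hx _)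
      fun n => ?_
    have h1 := thetaTerm_succ hq hx (-(n + 1 : ℕ) : ℤ)
    rw [show (-(n + 1 : ℕ) : ℤ) + 1 = -n by push_cast; ring] at h1
    rw [h1, zpow_neg, zpow_natCast]
    field_simp
    ring

/-- The finite `q`-binomial theorem. -/
lemma qPoch_div_qPoch (hq1 : ‖q‖ < 1) (hq : q ≠ 0) (hx : x ≠ 0) (N : ℕ) :
    qPoch x q N / qPoch q q N = ∑ p ∈ Finset.HasAntidiagonal.antidiagonal N,
      thetaTerm q (-x) p.2 / (qPoch q q p.1 * qPoch q q p.2) := by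
  have hne := one_sub_pow_succ_ne_zero hq1
  have hP := qPoch_ne_zero hne
  induction N with
  | zero => simp [qPoch_zero, thetaTerm_zero]
  | succ N ih =>
    let F : ℕ × ℕ → ℂ := fun p => thetaTerm q (-x) p.2 / (qPoch q q p.1 * qPoch q q p.2)
    have hN := hne N
    -- The `q`-Pascal rule: for `p.1 + p.2 = N + 1`, split `1 - q^(N+1)` as `(1 - q^p.1) + q^p.1 (1
    -- - q^p.2)`; each part lowers one index.
    have h1 : ∑ p ∈ Finset.HasAntidiagonal.antidiagonal (N + 1), (1 - q ^ p.1) * F p =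
        ∑ p ∈ Finset.HasAntidiagonal.antidiagonal N, F p := by
      rw [Finset.Nat.sum_antidiagonal_succ]
      simp only [pow_zero, sub_self, zero_mul, zero_add]
      refine Finset.sum_congr rfl fun p _ => ?_
      have a1 := hP p.1
      have a2 := hP p.2
      have a3 := hne p.1
      simp only [F, qPoch_succ, pow_succ']
      field_simp
    have h2 : ∑ p ∈ Finset.HasAntidiagonal.antidiagonal (N + 1), q ^ p.1 * (1 - q ^ p.2) * F p =
        ∑ p ∈ Finset.HasAntidiagonal.antidiagonal N, -x * q ^ N * F p := by
      rw [Finset.Nat.sum_antidiagonal_succ']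
      simp only [pow_zero, sub_self, zero_mul, mul_zero, zero_add]
      refine Finset.sum_congr rfl fun p hp => ?_
      have a1 := hP p.1
      have a2 := hP p.2
      have a3 := hne p.2
      rw [Finset.HasAntidiagonal.mem_antidiagonal] at hp
      simp only [F, qPoch_succ, pow_succ', ← hp, pow_add, Nat.cast_succ,
        thetaTerm_succ hq (neg_ne_zero.mpr hx), zpow_natCast]
      field_simp
    have h3 : (1 - q * q ^ N) * ∑ p ∈ Finset.HasAntidiagonal.antidiagonal (N + 1), F p =
        (1 - x * q ^ N) * ∑ p ∈ Finset.HasAntidiagonal.antidiagonal N, F p := by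
      rw [show 1 - x * q ^ N = 1 + -x * q ^ N by ring, add_mul, one_mul,
        Finset.mul_sum _ _ (-x * q ^ N), ← h1, ← h2, ← Finset.sum_add_distrib, Finset.mul_sum]
      refine Finset.sum_congr rfl fun p hp => ?_
      rw [Finset.HasAntidiagonal.mem_antidiagonal] at hp
      rw [← pow_succ', ← hp, pow_add]
      ring
    change _ = ∑ p ∈ Finset.HasAntidiagonal.antidiagonal (N + 1), F p
    rw [qPoch_succ, qPoch_succ, mul_div_mul_comm, ih, mul_comm, div_mul_eq_mul_div,
      div_eq_iff hN, mul_comm _ (1 - q * q ^ N), h3]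

lemma qPoch_mul_zpow_neg (hq : q ≠ 0) (hx : x ≠ 0) (n : ℕ) :
    qPoch (x * q ^ (-n : ℤ)) q n =
      thetaTerm q (-x) n * q ^ (-(n * n) : ℤ) * qPoch (q / x) q n := by
  induction n with
  | zero => simp [qPoch_zero, thetaTerm_zero]
  | succ n ih =>
    have e1 : x * q ^ (-(n + 1 : ℕ) : ℤ) * q ^ 1 = x * q ^ (-n : ℤ) := by
      rw [pow_one, mul_assoc, ← zpow_add_one₀ hq]; congr 2; push_cast; ring
    rw [add_comm n 1, qPoch_add, add_comm 1 n, e1, ih, qPoch_succ (q / x), Nat.cast_succ,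
      thetaTerm_succ hq (neg_ne_zero.mpr hx)]
    have e2 : q ^ (-((n + 1 : ℤ) * (n + 1))) =
        q ^ (-(n * n) : ℤ) * (q ^ n)⁻¹ * (q ^ n)⁻¹ * q⁻¹ := by
      rw [show -((n + 1 : ℤ) * (n + 1)) = -(n * n) + -n + -n + -1 by ring, zpow_add₀ hq,
        zpow_add₀ hq, zpow_add₀ hq, zpow_neg q n, zpow_natCast, zpow_neg_one]
    have e3 : q ^ (-((n : ℤ) + 1)) = (q ^ n)⁻¹ * q⁻¹ := by
      rw [neg_add, zpow_add₀ hq, zpow_neg, zpow_natCast, zpow_neg_one]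
    rw [e2, e3, zpow_natCast]
    simp only [qPoch, Finset.range_one, Finset.prod_singleton, pow_zero, mul_one]
    field_simp
    ring

/-- The finite form of the Jacobi triple product. -/
lemma finite_triple_product (hq1 : ‖q‖ < 1) (hq : q ≠ 0) (hx : x ≠ 0) (n : ℕ) :
    qPoch x q n * qPoch (q / x) q n / qPoch q q (2 * n) =
      ∑ p ∈ Finset.HasAntidiagonal.antidiagonal (2 * n),
        thetaTerm q (-x) (p.2 - n) / (qPoch q q p.1 * qPoch q q p.2) := by
  have hx' := neg_ne_zero.mpr hx
  have hy : x * q ^ (-n : ℤ) ≠ 0 := mul_ne_zero hx (zpow_ne_zero _ hq)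
  -- The binomial theorem at `x q^(-n)` with `2n` factors is centred: the first `n` factors reverse
  -- into `(q/x;q)_n`, and the common factor `K` cancels.
  have h := qPoch_div_qPoch hq1 hq hy (2 * n)
  set K := thetaTerm q (-x) n * q ^ (-(n * n) : ℤ) with hK
  have hK0 : K ≠ 0 := mul_ne_zero (thetaTerm_ne_zero hq hx' _) (zpow_ne_zero _ hq)
  have hterm : ∀ j : ℕ, thetaTerm q (-(x * q ^ (-n : ℤ))) j = K * thetaTerm q (-x) (j - n) := by
    intro j
    have h1 := thetaTerm_add hq hx' (j - n) n
    rw [sub_add_cancel] at h1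
    have h2 : thetaTerm q (-(x * q ^ (-n : ℤ))) j = thetaTerm q (-x) j * q ^ (-n * j : ℤ) := by
      rw [thetaTerm, thetaTerm, ← neg_mul, mul_zpow, ← zpow_mul, mul_assoc]
    rw [h2, h1, hK, mul_assoc _ (q ^ _), ← zpow_add₀ hq,
      show ((j : ℤ) - n) * n + -n * j = -(n * n) by ring]
    ring
  simp only [hterm, mul_div_assoc] at h
  rw [← Finset.mul_sum, two_mul, qPoch_add, qPoch_mul_zpow_neg hq hx, ← hK, mul_assoc x,
    ← zpow_natCast q n, ← zpow_add₀ hq, neg_add_cancel, zpow_zero, mul_one, mul_assoc K,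
    mul_div_assoc] at h
  rw [two_mul, mul_comm (qPoch x q n)]
  exact mul_left_cancel₀ hK0 h

/-- The Jacobi triple product identity. -/
theorem tsum_thetaTerm (hq1 : ‖q‖ < 1) (hq : q ≠ 0) (hx : x ≠ 0) :
    ∑' n : ℤ, thetaTerm q (-x) n = qPochInf q q * (qPochInf x q * qPochInf (q / x) q) := by
  have hne := one_sub_pow_succ_ne_zero hq1
  have hP := qPoch_ne_zero hne
  have hI := qPochInf_ne_zero hq1 hne
  obtain ⟨D, hD, hbd⟩ := exists_norm_inv_qPoch_le hq1 hne
  have hbd' : ∀ n, ‖(qPoch q q n)⁻¹‖ ≤ D := fun n => by simpa using hbd 0 n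
  -- The finite identity extended by zero to all of `ℤ`, with `h = p.2 - n`, so that dominated
  -- convergence applies.
  let T : ℕ → ℤ → ℂ := fun n h => if h.natAbs ≤ n then
    thetaTerm q (-x) h * ((qPoch q q (n - h).toNat)⁻¹ * (qPoch q q (n + h).toNat)⁻¹) else 0
  have hT : ∀ n, ∑' h, T n h = qPoch x q n * qPoch (q / x) q n / qPoch q q (2 * n) := by
    intro n
    rw [finite_triple_product hq1 hq hx, tsum_eq_sum (s := Finset.Icc (-n : ℤ) n)]
    · refine Finset.sum_bij' (fun h _ => ((n - h).toNat, (n + h).toNat))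
        (fun p _ => (p.2 : ℤ) - n) ?_ ?_ ?_ ?_ ?_
      · intro h hh; rw [Finset.mem_Icc] at hh; rw [Finset.HasAntidiagonal.mem_antidiagonal]; omega
      · intro p hp; rw [Finset.HasAntidiagonal.mem_antidiagonal] at hp; rw [Finset.mem_Icc]; omega
      · intro h hh; rw [Finset.mem_Icc] at hh; dsimp only; omega
      · intro p hp; rw [Finset.HasAntidiagonal.mem_antidiagonal] at hp
        ext <;> dsimp only <;> omega
      · intro h hh; rw [Finset.mem_Icc] at hh
        simp only [T]
        rw [if_pos (by omega), show (((n + h).toNat : ℕ) : ℤ) - n = h by omega, div_eq_mul_inv,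
          mul_inv]
    · intro h hh; rw [Finset.mem_Icc] at hh
      exact if_neg (by omega)
  have hlim := tendsto_tsum_of_dominated_convergence (f := T)
    (g := fun h => thetaTerm q (-x) h * ((qPochInf q q)⁻¹ * (qPochInf q q)⁻¹))
    ((summable_norm_thetaTerm hq hq1 (neg_ne_zero.mpr hx)).mul_right (D * D))
    (fun h => by
      have t1 : Tendsto (fun n : ℕ => ((n : ℤ) - h).toNat) atTop atTop :=
        tendsto_atTop_atTop.mpr fun b => ⟨(b + h).toNat, fun n hn => by omega⟩
      have t2 : Tendsto (fun n : ℕ => ((n : ℤ) + h).toNat) atTop atTop :=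
        tendsto_atTop_atTop.mpr fun b => ⟨(b - h).toNat, fun n hn => by omega⟩
      have hc := (tendsto_qPoch hq1 q).inv₀ hI
      refine (((hc.comp t1).mul (hc.comp t2)).const_mul (thetaTerm q (-x) h)).congr' ?_
      filter_upwards [eventually_ge_atTop h.natAbs] with n hn
      simp only [T, if_pos hn, Function.comp])
    (Eventually.of_forall fun n h => by
      simp only [T]
      split_ifs
      · exact norm_mul_le_of_le le_rfl (norm_mul_le_of_le (hbd' _) (hbd' _))
      · rw [norm_zero]; positivity)
  simp only [hT, tsum_mul_right] at hlim
  have hlim2 := ((tendsto_qPoch hq1 x).mul (tendsto_qPoch hq1 (q / x))).div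
    ((tendsto_qPoch hq1 q).comp (tendsto_id.const_mul_atTop' two_pos)) hI
  have := tendsto_nhds_unique hlim hlim2
  field_simp at this
  rw [this, mul_assoc]

end

/-! ### Parity splitting and the Weierstrass relation. -/

/-- The even part of the theta series. -/
def thetaEven (q x : ℂ) : ℂ := ∑' n : ℤ, q ^ (n * n) * x ^ (2 * n)

/-- The odd part of the theta series. -/
def thetaOdd (q x : ℂ) : ℂ := ∑' n : ℤ, q ^ (n * n + n) * x ^ (2 * n + 1)

/-- Pairs of integers sorted by the parity of their sum. -/
def parityMap : (ℤ × ℤ) ⊕ (ℤ × ℤ) → ℤ × ℤ :=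
  Sum.elim (fun p => (p.1 + p.2, p.1 - p.2)) (fun p => (p.1 + p.2 + 1, p.1 - p.2))

lemma parityMap_bijective : Function.Bijective parityMap := by
  constructor
  · rintro (⟨i, j⟩ | ⟨i, j⟩) (⟨i', j'⟩ | ⟨i', j'⟩) h <;>
      simp only [parityMap, Sum.elim_inl, Sum.elim_inr, Prod.mk.injEq, Sum.inl.injEq,
        Sum.inr.injEq, reduceCtorEq] at h ⊢ <;> omega
  · rintro ⟨m, n⟩
    rcases Int.emod_two_eq_zero_or_one (m + n) with h | h
    · refine ⟨Sum.inl ((m + n) / 2, (m - n) / 2), ?_⟩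
      simp only [parityMap, Sum.elim_inl, Prod.mk.injEq]; omega
    · refine ⟨Sum.inr ((m + n) / 2, (m - n) / 2), ?_⟩
      simp only [parityMap, Sum.elim_inr, Prod.mk.injEq]; omega

section

variable {q x y : ℂ}

/-- The even part is a theta series to the base `q ^ 2`, whence its summability; `thetaTerm_sq'`
does the same for the odd part. -/
lemma thetaTerm_sq (hq : q ≠ 0) (x : ℂ) (n : ℤ) :
    thetaTerm (q ^ 2) (q * x ^ 2) n = q ^ (n * n) * x ^ (2 * n) := by
  rw [thetaTerm, mul_zpow, ← zpow_natCast q 2, ← zpow_natCast x 2, ← zpow_mul, ← zpow_mul,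
    ← mul_assoc, ← zpow_add₀ hq]
  push_cast
  rw [two_mul_tri, show n * (n - 1) + n = n * n by ring]

lemma thetaTerm_sq' (hq : q ≠ 0) (hx : x ≠ 0) (n : ℤ) :
    x * thetaTerm (q ^ 2) (q ^ 2 * x ^ 2) n = q ^ (n * n + n) * x ^ (2 * n + 1) := by
  rw [thetaTerm, mul_zpow, ← zpow_natCast q 2, ← zpow_natCast x 2, ← zpow_mul, ← zpow_mul,
    ← zpow_mul, ← mul_assoc (q ^ _), ← zpow_add₀ hq, zpow_add_one₀ hx]
  push_cast
  rw [two_mul_tri, show n * (n - 1) + 2 * n = n * n + n by ring]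
  ring

lemma tri_add_tri_sub (i j : ℤ) :
    tri (i + j) + tri (i - j) = (i - 1) * (i - 1) + (i - 1) + j * j := by
  have h1 := two_mul_tri (i + j)
  have h2 := two_mul_tri (i - j)
  have : 2 * (tri (i + j) + tri (i - j)) = 2 * ((i - 1) * (i - 1) + (i - 1) + j * j) := by
    rw [mul_add, h1, h2]; ring
  omega

lemma tri_add_one_add_tri_sub (i j : ℤ) :
    tri (i + j + 1) + tri (i - j) = i * i + (j * j + j) := by
  have h1 := two_mul_tri (i + j + 1)
  have h2 := two_mul_tri (i - j)
  have : 2 * (tri (i + j + 1) + tri (i - j)) = 2 * (i * i + (j * j + j)) := by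
    rw [mul_add, h1, h2]; ring
  omega

/-- The exponent `tri (i + j) + tri (i - j) = i² - i + j²` separates the variables; the index `i -
1` exhibits the `x`-part as a term of `thetaOdd`. -/
lemma thetaTerm_mul_even (hq : q ≠ 0) (hx : x ≠ 0) (hy : y ≠ 0) (i j : ℤ) :
    thetaTerm q (-(x * y)) (i + j) * thetaTerm q (-(x / y)) (i - j) =
      x * (q ^ ((i - 1) * (i - 1) + (i - 1)) * x ^ (2 * (i - 1) + 1)) *
        (q ^ (j * j) * y ^ (2 * j)) := by
  have e1 : (-(x * y)) ^ (i + j) * (-(x / y)) ^ (i - j) = x ^ (2 * i) * y ^ (2 * j) := by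
    rw [← neg_one_mul (x * y), ← neg_one_mul (x / y), mul_zpow, mul_zpow, mul_zpow, div_zpow]
    have s1 : (-1 : ℂ) ^ (i + j) * (-1) ^ (i - j) = 1 := by
      rw [← zpow_add₀ (by norm_num)]
      exact Even.neg_one_zpow ⟨i, by ring⟩
    have s2 : x ^ (i + j) * x ^ (i - j) = x ^ (2 * i) := by
      rw [← zpow_add₀ hx]; congr 1; ring
    have s3 : y ^ (i + j) / y ^ (i - j) = y ^ (2 * j) := by
      rw [← zpow_sub₀ hy]; congr 1; ring
    rw [← s2, ← s3]
    linear_combination (x ^ (i + j) * x ^ (i - j) * (y ^ (i + j) / y ^ (i - j))) * s1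
  have e2 : x * x ^ (2 * (i - 1) + 1) = x ^ (2 * i) := by
    rw [mul_comm, ← zpow_add_one₀ hx]; congr 1; ring
  calc _ = q ^ tri (i + j) * q ^ tri (i - j) *
        ((-(x * y)) ^ (i + j) * (-(x / y)) ^ (i - j)) := by simp only [thetaTerm]; ring
    _ = _ := by rw [e1, ← zpow_add₀ hq, tri_add_tri_sub, ← e2, zpow_add₀ hq _ (j * j)]; ring

lemma thetaTerm_mul_odd (hq : q ≠ 0) (hx : x ≠ 0) (hy : y ≠ 0) (i j : ℤ) :
    thetaTerm q (-(x * y)) (i + j + 1) * thetaTerm q (-(x / y)) (i - j) =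
      -x * (q ^ (i * i) * x ^ (2 * i)) * (q ^ (j * j + j) * y ^ (2 * j + 1)) := by
  have e1 : (-(x * y)) ^ (i + j + 1) * (-(x / y)) ^ (i - j) =
      -(x * x ^ (2 * i) * y ^ (2 * j + 1)) := by
    rw [← neg_one_mul (x * y), ← neg_one_mul (x / y), mul_zpow, mul_zpow, mul_zpow, div_zpow]
    have s1 : (-1 : ℂ) ^ (i + j + 1) * (-1) ^ (i - j) = -1 := by
      rw [← zpow_add₀ (by norm_num)]
      exact Odd.neg_one_zpow ⟨i, by ring⟩
    have s2 : x ^ (i + j + 1) * x ^ (i - j) = x * x ^ (2 * i) := by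
      rw [← zpow_add₀ hx, mul_comm x, ← zpow_add_one₀ hx]; congr 1; ring
    have s3 : y ^ (i + j + 1) / y ^ (i - j) = y ^ (2 * j + 1) := by
      rw [← zpow_sub₀ hy]; congr 1; ring
    rw [← s2, ← s3]
    linear_combination (x ^ (i + j + 1) * x ^ (i - j) * (y ^ (i + j + 1) / y ^ (i - j))) * s1
  calc _ = q ^ tri (i + j + 1) * q ^ tri (i - j) *
        ((-(x * y)) ^ (i + j + 1) * (-(x / y)) ^ (i - j)) := by simp only [thetaTerm]; ring
    _ = _ := by rw [e1, ← zpow_add₀ hq, tri_add_one_add_tri_sub, zpow_add₀ hq (i * i)]; ring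

/-- Splitting the double sum by the parity of the index sum, each half factors into a product of two
single series. -/
lemma tsum_thetaTerm_mul_tsum (hq1 : ‖q‖ < 1) (hq : q ≠ 0) (hx : x ≠ 0) (hy : y ≠ 0) :
    (∑' n : ℤ, thetaTerm q (-(x * y)) n) * ∑' n : ℤ, thetaTerm q (-(x / y)) n =
      x * (thetaOdd q x * thetaEven q y - thetaEven q x * thetaOdd q y) := by
  have hq2 : ‖q ^ 2‖ < 1 := by
    rw [norm_pow]; exact pow_lt_one₀ (norm_nonneg _) hq1 two_ne_zero
  have hq20 : q ^ 2 ≠ 0 := pow_ne_zero _ hq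
  have hE : ∀ {w : ℂ}, w ≠ 0 → Summable fun n : ℤ => ‖q ^ (n * n) * w ^ (2 * n)‖ := fun hw => by
    simp only [← thetaTerm_sq hq]
    exact summable_norm_thetaTerm hq20 hq2 (mul_ne_zero hq (pow_ne_zero _ hw))
  have hO : ∀ {w : ℂ}, w ≠ 0 → Summable fun n : ℤ => ‖q ^ (n * n + n) * w ^ (2 * n + 1)‖ :=
    fun {w} hw => by
      simp only [← thetaTerm_sq' hq hw, norm_mul w]
      exact (summable_norm_thetaTerm hq20 hq2 (mul_ne_zero hq20 (pow_ne_zero _ hw))).mul_left _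
  have h1 := summable_norm_thetaTerm hq hq1 (neg_ne_zero.mpr (mul_ne_zero hx hy))
  have h2 := summable_norm_thetaTerm hq hq1 (neg_ne_zero.mpr (div_ne_zero hx hy))
  have hprod : ∀ {f g : ℤ → ℂ}, (Summable fun n => ‖f n‖) → (Summable fun n => ‖g n‖) →
      HasSum (fun p : ℤ × ℤ => f p.1 * g p.2) ((∑' n, f n) * ∑' n, g n) := fun hf hg => by
    rw [tsum_mul_tsum_of_summable_norm hf hg]
    exact (summable_mul_of_summable_norm hf hg).hasSum
  have heven : HasSum (fun p : ℤ × ℤ => thetaTerm q (-(x * y)) (p.1 + p.2) *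
      thetaTerm q (-(x / y)) (p.1 - p.2)) (x * (thetaOdd q x * thetaEven q y)) := by
    have hs := ((Equiv.subRight (1 : ℤ)).summable_iff (f := fun n : ℤ =>
      ‖q ^ (n * n + n) * x ^ (2 * n + 1)‖)).mpr (hO hx)
    have hsum := (Equiv.subRight (1 : ℤ)).tsum_eq fun n : ℤ =>
      q ^ (n * n + n) * x ^ (2 * n + 1)
    simp only [Function.comp_def, Equiv.subRight_apply] at hs hsum
    have := (hprod hs (hE hy)).mul_left x
    rw [hsum] at this
    refine this.congr_fun fun p => ?_
    rw [thetaTerm_mul_even hq hx hy]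
    ring
  have hodd : HasSum (fun p : ℤ × ℤ => thetaTerm q (-(x * y)) (p.1 + p.2 + 1) *
      thetaTerm q (-(x / y)) (p.1 - p.2)) (-x * (thetaEven q x * thetaOdd q y)) := by
    refine ((hprod (hE hx) (hO hy)).mul_left (-x)).congr_fun fun p => ?_
    rw [thetaTerm_mul_odd hq hx hy]
    ring
  rw [tsum_mul_tsum_of_summable_norm h1 h2,
    ← (Equiv.ofBijective parityMap parityMap_bijective).tsum_eq]
  have := HasSum.sum (f := fun c => thetaTerm q (-(x * y)) (parityMap c).1 *
    thetaTerm q (-(x / y)) (parityMap c).2) heven hodd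
  simp only [Equiv.ofBijective_apply]
  rw [this.tsum_eq]
  ring

end

/-- The modified theta function `(x, q/x; q)_∞`. -/
def theta (x q : ℂ) : ℂ := qPochInf x q * qPochInf (q / x) q

section

variable {q : ℂ}

lemma exists_theta_mul_theta (hq1 : ‖q‖ < 1) (hq : q ≠ 0) :
    ∃ f g : ℂ → ℂ, ∀ x y : ℂ, x ≠ 0 → y ≠ 0 →
      theta (x * y) q * theta (x / y) q = x * (f x * g y - g x * f y) := by
  have hI := qPochInf_ne_zero hq1 (one_sub_pow_succ_ne_zero hq1)
  refine ⟨fun x => thetaOdd q x / qPochInf q q, fun x => thetaEven q x / qPochInf q q,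
    fun x y hx hy => ?_⟩
  have h := tsum_thetaTerm_mul_tsum hq1 hq hx hy
  rw [tsum_thetaTerm hq1 hq (mul_ne_zero hx hy), tsum_thetaTerm hq1 hq (div_ne_zero hx hy)] at h
  change qPochInf q q * theta (x * y) q * (qPochInf q q * theta (x / y) q) = _ at h
  generalize theta (x * y) q = t₁ at *
  generalize theta (x / y) q = t₂ at *
  field_simp
  linear_combination h

/-- The Weierstrass three-term relation. -/
lemma theta_three_term (hq1 : ‖q‖ < 1) (hq : q ≠ 0) {x y u v : ℂ} (hx : x ≠ 0) (hy : y ≠ 0)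
    (hu : u ≠ 0) (hv : v ≠ 0) :
    theta (x * y) q * theta (x / y) q * (theta (u * v) q * theta (u / v) q) -
      theta (x * v) q * theta (x / v) q * (theta (u * y) q * theta (u / y) q) =
      u / y * (theta (y * v) q * theta (y / v) q) * (theta (x * u) q * theta (x / u) q) := by
  obtain ⟨f, g, h⟩ := exists_theta_mul_theta hq1 hq
  -- What remains is the Plücker relation among the 2×2 minors of the vectors `(f, g)` at `x`, `y`,
  -- `u`, `v`.
  rw [h x y hx hy, h u v hu hv, h x v hx hv, h u y hu hy, h y v hy hv, h x u hx hu]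
  field_simp
  ring

end

/-! ### Logarithmic derivatives and the addition formula. -/

section

variable {q : ℂ}

lemma multipliableLocallyUniformlyOn_qPoch (hq : ‖q‖ < 1) (R : ℝ) :
    MultipliableLocallyUniformlyOn (fun (i : ℕ) (x : ℂ) => 1 - x * q ^ i) (Metric.ball 0 R) := by
  have := Summable.multipliableLocallyUniformlyOn_nat_one_add
    (f := fun (i : ℕ) (x : ℂ) => -(x * q ^ i))
    (K := Metric.ball (0 : ℂ) R) Metric.isOpen_ball
    ((summable_geometric_of_lt_one (norm_nonneg _) hq).mul_left R)
    (Eventually.of_forall fun i x hx => by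
      rw [norm_neg, norm_mul, norm_pow]
      rw [mem_ball_zero_iff] at hx
      exact mul_le_mul_of_nonneg_right hx.le (by positivity))
    (fun i => by fun_prop)
  simpa only [← sub_eq_add_neg] using this

lemma differentiable_qPochInf (hq : ‖q‖ < 1) : Differentiable ℂ fun x => qPochInf x q := by
  intro x
  have hx : x ∈ Metric.ball (0 : ℂ) (‖x‖ + 1) := by simp
  refine DifferentiableOn.differentiableAt (s := Metric.ball (0 : ℂ) (‖x‖ + 1)) ?_
    (Metric.isOpen_ball.mem_nhds hx)
  exact (multipliableLocallyUniformlyOn_qPoch hq _).hasProdLocallyUniformlyOn.differentiableOn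
    (.of_forall fun _ => by
      simpa [Finset.prod_fn] using DifferentiableOn.finsetProd (fun _ _ => by fun_prop))
    Metric.isOpen_ball

lemma mul_deriv_qPochInf (hq : ‖q‖ < 1) {x : ℂ} (h : ∀ i : ℕ, 1 - x * q ^ i ≠ 0) :
    x * deriv (fun x => qPochInf x q) x = -lambert x q * qPochInf x q := by
  have hx : x ∈ Metric.ball (0 : ℂ) (‖x‖ + 1) := by simp
  have hI := qPochInf_ne_zero hq h
  have hd : ∀ i : ℕ, x * logDeriv (fun x : ℂ => 1 - x * q ^ i) x =
      -(x * q ^ i / (1 - x * q ^ i)) := by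
    intro i
    rw [logDeriv_apply, deriv_const_sub, deriv_mul_const differentiableAt_id, deriv_id'']
    ring
  -- Summability is obtained after multiplication by `x`, which needs `x ≠ 0`.
  by_cases hx0 : x = 0
  · subst hx0; simp [lambert]
  have hsum : Summable fun i : ℕ => logDeriv (fun x : ℂ => 1 - x * q ^ i) x := by
    rw [← summable_mul_left_iff hx0]
    simp only [hd]
    exact (summable_lambert hq h).neg
  have key := logDeriv_tprod_eq_tsum Metric.isOpen_ball hx h (fun i => by fun_prop) hsum
    (multipliableLocallyUniformlyOn_qPoch hq _) hI
  have h2 : x * logDeriv (fun x => qPochInf x q) x = -lambert x q := by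
    unfold qPochInf
    rw [key, ← tsum_mul_left]
    simp only [hd, tsum_neg, lambert]
  rw [logDeriv_apply] at h2
  rw [← h2]
  field_simp

lemma differentiableAt_theta (hq : ‖q‖ < 1) {x : ℂ} (hx : x ≠ 0) :
    DifferentiableAt ℂ (fun x => theta x q) x := by
  have h := differentiable_qPochInf hq
  have h1 : DifferentiableAt ℂ (fun x => qPochInf (q / x) q) x :=
    (h (q / x)).comp x (by fun_prop (disch := assumption))
  exact (h x).mul h1

/-- `(x;q)_∞ (q/x;q)_∞` has no zero at `x`. -/
structure ThetaRegular (q x : ℂ) : Prop where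
  ne_zero : x ≠ 0
  pow : ∀ i : ℕ, 1 - x * q ^ i ≠ 0
  pow_inv : ∀ i : ℕ, 1 - q / x * q ^ i ≠ 0

lemma ThetaRegular.theta_ne_zero (hq : ‖q‖ < 1) {x : ℂ} (h : ThetaRegular q x) :
    theta x q ≠ 0 :=
  mul_ne_zero (qPochInf_ne_zero hq h.pow) (qPochInf_ne_zero hq h.pow_inv)

/-- Minus the logarithmic derivative `x θ'(x) / θ(x)` of the theta function. -/
def zeta (x q : ℂ) : ℂ := lambert x q - lambert (q / x) q

lemma mul_deriv_theta (hq : ‖q‖ < 1) {x : ℂ} (h : ThetaRegular q x) :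
    x * deriv (fun x => theta x q) x = -zeta x q * theta x q := by
  have hx := h.ne_zero
  have hd := differentiable_qPochInf hq
  have h1 : HasDerivAt (fun x => qPochInf (q / x) q)
      (deriv (fun x => qPochInf x q) (q / x) * (-q / x ^ 2)) x := by
    refine (hd (q / x)).hasDerivAt.comp x ?_
    have := (hasDerivAt_inv hx).const_mul q
    simp only [← div_eq_mul_inv] at this
    convert this using 1
    ring
  have h2 : HasDerivAt (fun x => theta x q) _ x := (hd x).hasDerivAt.mul h1
  have e1 := mul_deriv_qPochInf hq h.pow
  have e2 := mul_deriv_qPochInf hq h.pow_inv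
  rw [h2.deriv, zeta, theta]
  generalize deriv (fun x => qPochInf x q) (q / x) = d₂ at *
  generalize deriv (fun x => qPochInf x q) x = d₁ at *
  have e3 : x * (-q / x ^ 2) = -(q / x) := by field_simp
  linear_combination qPochInf (q / x) q * e1 + qPochInf x q * d₂ * e3 - qPochInf x q * e2

lemma theta_eq (hq : ‖q‖ < 1) (x : ℂ) :
    theta x q = (1 - x) * (qPochInf (x * q) q * qPochInf (q / x) q) := by
  rw [theta, qPochInf_eq_mul_qPochInf hq, mul_assoc]

lemma theta_one (hq : ‖q‖ < 1) : theta 1 q = 0 := by simp [theta_eq hq]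

/-- The factor `1 - x` in `theta_eq` gives a zero at `1`; the cofactor there is `(q;q)_∞²`. -/
lemma hasDerivAt_theta_one (hq : ‖q‖ < 1) :
    HasDerivAt (fun x => theta x q) (-qPochInf q q ^ 2) 1 := by
  have h := differentiable_qPochInf hq
  have h1 : DifferentiableAt ℂ (fun x => qPochInf (x * q) q * qPochInf (q / x) q) 1 := by
    refine DifferentiableAt.mul (a := fun x => qPochInf (x * q) q)
      ((h (1 * q)).comp (1 : ℂ) (f := fun x => x * q) (by fun_prop))
      ((h (q / 1)).comp (1 : ℂ) (f := fun x => q / x) (by fun_prop (disch := norm_num)))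
  have h2 := ((hasDerivAt_id (1 : ℂ)).const_sub 1).mul h1.hasDerivAt
  have h3 : (fun x => theta x q) =
      (fun x => (1 - id x)) * fun x => qPochInf (x * q) q * qPochInf (q / x) q :=
    funext fun x => theta_eq hq x
  rw [h3]
  refine h2.congr_deriv ?_
  simp
  ring

lemma theta_inv (hq : ‖q‖ < 1) {x : ℂ} (hx : x ≠ 0) : theta x⁻¹ q = -x⁻¹ * theta x q := by
  rw [theta_eq hq, theta_eq hq x, div_inv_eq_mul, mul_comm q x, ← mul_comm q x⁻¹, ← div_eq_mul_inv]
  field_simp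
  ring

/-- The addition formula for the logarithmic derivative of the theta function. -/
theorem zeta_addition (hq : ‖q‖ < 1) (hq0 : q ≠ 0) {x y u : ℂ} (h1 : ThetaRegular q (x * y))
    (h2 : ThetaRegular q (x / y)) (h3 : ThetaRegular q (u * y)) (h4 : ThetaRegular q (u / y)) :
    zeta (x * y) q - zeta (x / y) q + zeta (u / y) q - zeta (u * y) q =
      u / y * qPochInf q q ^ 2 * theta (y * y) q * (theta (x * u) q * theta (x / u) q) /
        (theta (x * y) q * theta (x / y) q * (theta (u * y) q * theta (u / y) q)) := by
  have hx : x ≠ 0 := left_ne_zero_of_mul h1.ne_zero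
  have hy : y ≠ 0 := right_ne_zero_of_mul h1.ne_zero
  have hu : u ≠ 0 := left_ne_zero_of_mul h3.ne_zero
  have dmul : ∀ c : ℂ, c ≠ 0 → HasDerivAt (fun v => theta (c * v) q)
      (deriv (fun x => theta x q) (c * y) * c) y := fun c hc => by
    have := (hasDerivAt_id y).const_mul c
    rw [mul_one] at this
    exact (differentiableAt_theta hq (mul_ne_zero hc hy)).hasDerivAt.comp y this
  have dinv : ∀ c : ℂ, HasDerivAt (fun v => c / v) (-(c / y) / y) y := fun c => by
    have := (hasDerivAt_const y c).div (hasDerivAt_id y) hy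
    refine this.congr_deriv ?_
    simp only [id]
    field_simp
    ring
  have ddiv : ∀ c : ℂ, c ≠ 0 → HasDerivAt (fun v => theta (c / v) q)
      (deriv (fun x => theta x q) (c / y) * (-(c / y) / y)) y := fun c hc =>
    (differentiableAt_theta hq (div_ne_zero hc hy)).hasDerivAt.comp y (dinv c)
  -- The three-term relation is differentiated in `v` at `v = y`. On its right side `θ(y/v)`
  -- vanishes there, so only the derivative of that factor contributes.
  have dlhs := (((dmul u hu).mul (ddiv u hu)).const_mul
      (theta (x * y) q * theta (x / y) q)).sub
    (((dmul x hx).mul (ddiv x hx)).mul_const (theta (u * y) q * theta (u / y) q))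
  have done : HasDerivAt (fun v => theta (y / v) q) (-qPochInf q q ^ 2 * (-(y / y) / y)) y := by
    have : HasDerivAt (fun x => theta x q) (-qPochInf q q ^ 2) (y / y) := by
      rw [div_self hy]; exact hasDerivAt_theta_one hq
    exact this.comp y (dinv y)
  have drhs := (((dmul y hy).mul done).const_mul (u / y)).mul_const
    (theta (x * u) q * theta (x / u) q)
  have heq := dlhs.congr_of_eventuallyEq (f₁ := fun v =>
      u / y * (theta (y * v) q * theta (y / v) q) * (theta (x * u) q * theta (x / u) q)) (by
    filter_upwards [isOpen_ne.mem_nhds hy] with v hv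
    exact (theta_three_term hq hq0 hx hy hu hv).symm)
  have key := heq.unique drhs
  have e1 := mul_deriv_theta hq h1
  have e2 := mul_deriv_theta hq h2
  have e3 := mul_deriv_theta hq h3
  have e4 := mul_deriv_theta hq h4
  have n1 := h1.theta_ne_zero hq
  have n2 := h2.theta_ne_zero hq
  have n3 := h3.theta_ne_zero hq
  have n4 := h4.theta_ne_zero hq
  rw [div_self hy, theta_one hq, mul_zero, zero_add] at key
  generalize deriv (fun x => theta x q) (x * y) = d₁ at *
  generalize deriv (fun x => theta x q) (x / y) = d₂ at *
  generalize deriv (fun x => theta x q) (u * y) = d₃ at *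
  generalize deriv (fun x => theta x q) (u / y) = d₄ at *
  generalize theta (x * y) q = t₁ at *
  generalize theta (x / y) q = t₂ at *
  generalize theta (u * y) q = t₃ at *
  generalize theta (u / y) q = t₄ at *
  generalize zeta (x * y) q = z₁ at *
  generalize zeta (x / y) q = z₂ at *
  generalize zeta (u * y) q = z₃ at *
  generalize zeta (u / y) q = z₄ at *
  rw [eq_div_iff (by simp [*])]
  have a1 : y * (-(u / y) / y) = -(u / y) := by field_simp
  have a2 : y * (-(x / y) / y) = -(x / y) := by field_simp
  have a3 : y * (-1 / y) = -1 := by field_simp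
  linear_combination y * key - t₁ * t₂ * t₄ * e3 - t₁ * t₂ * t₃ * d₄ * a1 + t₁ * t₂ * t₃ * e4 +
    t₂ * t₃ * t₄ * e1 + t₁ * t₃ * t₄ * d₂ * a2 - t₁ * t₃ * t₄ * e2 -
    (u / y * theta (y * y) q * qPochInf q q ^ 2 * (theta (x * u) q * theta (x / u) q)) * a3

end

/-! ### Evaluation of the Lambert series. -/

section

variable {q a k z : ℂ}

lemma lambert_eq (hq : ‖q‖ < 1) {x : ℂ} (h : ∀ i : ℕ, 1 - x * q ^ i ≠ 0) :
    lambert x q = x / (1 - x) + lambert (q * x) q := by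
  rw [lambert, (summable_lambert hq h).tsum_eq_zero_add, lambert]
  simp only [pow_zero, mul_one, pow_succ']
  congr 2
  funext i
  ring_nf

lemma Admissible.thetaRegular_k (h : Admissible q a k z) (h' : Admissible q (1 / a) (1 / k) (1 / z))
    (hk : k ≠ 0) : ThetaRegular q k where
  ne_zero := hk
  pow := h.k_pow
  pow_inv i := by
    have := h'.qk_pow i
    rwa [mul_one_div] at this

lemma Admissible.thetaRegular_a (h : Admissible q a k z)
    (h' : Admissible q (1 / a) (1 / k) (1 / z)) : ThetaRegular q a where
  ne_zero := h.a_ne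
  pow := h.a_pow
  pow_inv i := by
    have := h'.qa_pow i
    rwa [mul_one_div] at this

lemma Admissible.thetaRegular_kz (h : Admissible q a k z)
    (h' : Admissible q (1 / a) (1 / k) (1 / z)) (hk : k ≠ 0) : ThetaRegular q (k / z) where
  ne_zero := div_ne_zero hk h.z_ne
  pow := h.kz_pow
  pow_inv i := by
    have := h'.qkz_pow i
    rwa [mul_one_div, div_div_eq_mul_div, div_one, ← mul_div_right_comm,
      ← div_div_eq_mul_div] at this

lemma Admissible.thetaRegular_az (h : Admissible q a k z)
    (h' : Admissible q (1 / a) (1 / k) (1 / z)) : ThetaRegular q (a / z) where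
  ne_zero := div_ne_zero h.a_ne h.z_ne
  pow := h.az_pow
  pow_inv i := by
    have := h'.qaz_pow i
    rwa [mul_one_div, div_div_eq_mul_div, div_one, ← mul_div_right_comm,
      ← div_div_eq_mul_div] at this

lemma zeta_combination (h : Admissible q a k z) (h' : Admissible q (1 / a) (1 / k) (1 / z))
    (hk : k ≠ 0) :
    zeta k q - zeta (k / z) q + zeta (a / z) q - zeta a q =
      z / k * (qPochsInf [z, q / z, k / a, q * a / k, a * k / z, q * z / (a * k), q, q] q /
        qPochsInf [z / k, q * k / z, z / a, q * a / z, a, q / a, k, q / k] q) := by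
  have hq := h.norm_lt
  have ha := h.a_ne
  have hz := h.z_ne
  obtain ⟨y, hy⟩ : ∃ y : ℂ, y ^ 2 = z := IsAlgClosed.exists_pow_nat_eq z two_pos
  have hy0 : y ≠ 0 := by rintro rfl; exact hz (by rw [← hy]; ring)
  have e1 : k / y * y = k := div_mul_cancel₀ _ hy0
  have e2 : k / y / y = k / z := by rw [div_div, ← hy, sq]
  have e3 : a / y * y = a := div_mul_cancel₀ _ hy0
  have e4 : a / y / y = a / z := by rw [div_div, ← hy, sq]
  have e5 : k / y * (a / y) = a * k / z := by rw [div_mul_div_comm, ← hy, sq, mul_comm k]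
  have e6 : k / y / (a / y) = k / a := div_div_div_cancel_right₀ hy0 _ _
  have e7 : y * y = z := by rw [← hy, sq]
  -- With `y² = z` the arguments `xy, x/y, uy, u/y, xu, x/u` become `k, k/z, a, a/z, ak/z, k/a`.
  have key := zeta_addition hq h.q_ne (x := k / y) (y := y) (u := a / y)
    (by rw [e1]; exact h.thetaRegular_k h' hk) (by rw [e2]; exact h.thetaRegular_kz h' hk)
    (by rw [e3]; exact h.thetaRegular_a h') (by rw [e4]; exact h.thetaRegular_az h')
  rw [e1, e2, e3, e4, e5, e6, e7] at key
  rw [key]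
  have n1 := (h.thetaRegular_k h' hk).theta_ne_zero hq
  have n2 := (h.thetaRegular_kz h' hk).theta_ne_zero hq
  have n3 := (h.thetaRegular_a h').theta_ne_zero hq
  have n4 := (h.thetaRegular_az h').theta_ne_zero hq
  have i1 : theta (k / z) q = -(k / z) * theta (z / k) q := by
    have := theta_inv hq (div_ne_zero hz hk)
    rwa [inv_div] at this
  have i2 : theta (a / z) q = -(a / z) * theta (z / a) q := by
    have := theta_inv hq (div_ne_zero hz ha)
    rwa [inv_div] at this
  have m1 : qPochsInf [z, q / z, k / a, q * a / k, a * k / z, q * z / (a * k), q, q] q =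
      theta z q * theta (k / a) q * theta (a * k / z) q * qPochInf q q ^ 2 := by
    simp only [qPochsInf, theta, List.map_cons, List.map_nil, List.prod_cons, List.prod_nil,
      div_div_eq_mul_div]
    ring
  have m2 : qPochsInf [z / k, q * k / z, z / a, q * a / z, a, q / a, k, q / k] q =
      theta (z / k) q * theta (z / a) q * theta a q * theta k q := by
    simp only [qPochsInf, theta, List.map_cons, List.map_nil, List.prod_cons, List.prod_nil,
      div_div_eq_mul_div]
    ring
  rw [m1, m2]
  rw [i1] at n2 ⊢
  rw [i2] at n4 ⊢
  have n2' := right_ne_zero_of_mul n2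
  have n4' := right_ne_zero_of_mul n4
  generalize theta (z / k) q = t₁ at *
  generalize theta (z / a) q = t₂ at *
  generalize theta (k / a) q = t₃ at *
  generalize theta (a * k / z) q = t₄ at *
  field_simp

/-- Each pair such as `lambert (q * k) q - lambert (q / k) q` is `zeta k q - k / (1 - k)`; the four
rational parts combine to the first term on the right. -/
lemma lambert_combination (h : Admissible q a k z)
    (h' : Admissible q (1 / a) (1 / k) (1 / z)) (hk : k ≠ 0) :
    lambert (q * k) q - lambert (q * a) q + lambert (q * a / z) q - lambert (q * k / z) q -
      (lambert (q / k) q - lambert (q / a) q + lambert (q * z / a) q - lambert (q * z / k) q) =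
      (a - k) * (1 - 1 / z) * (1 - a * k / z) /
          ((1 - a) * (1 - k) * (1 - a / z) * (1 - k / z)) +
        z / k * (qPochsInf [z, q / z, k / a, q * a / k, a * k / z, q * z / (a * k), q, q] q /
          qPochsInf [z / k, q * k / z, z / a, q * a / z, a, q / a, k, q / k] q) := by
  have hq := h.norm_lt
  rw [← zeta_combination h h' hk]
  simp only [zeta]
  rw [lambert_eq hq h.k_pow, lambert_eq hq h.a_pow, lambert_eq hq h.kz_pow,
    lambert_eq hq h.az_pow, div_div_eq_mul_div, div_div_eq_mul_div, mul_div_assoc q k,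
    mul_div_assoc q a]
  have d1 : 1 - k ≠ 0 := h.one_sub_k
  have d2 : 1 - a ≠ 0 := by simpa using h.a_pow 0
  have d3 : 1 - k * z⁻¹ ≠ 0 := by simpa [div_eq_mul_inv] using h.kz_pow 0
  have d4 : 1 - a * z⁻¹ ≠ 0 := by simpa [div_eq_mul_inv] using h.az_pow 0
  have hrat : k / (1 - k) - k * z⁻¹ / (1 - k * z⁻¹) + a * z⁻¹ / (1 - a * z⁻¹) - a / (1 - a) =
      -((a - k) * (1 - 1 * z⁻¹) * (1 - a * k * z⁻¹) /
          ((1 - a) * (1 - k) * (1 - a * z⁻¹) * (1 - k * z⁻¹))) := by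
    generalize z⁻¹ = w at *
    have e1 : ∀ x : ℂ, 1 - x ≠ 0 → x / (1 - x) = 1 / (1 - x) - 1 := by
      intro x hx; field_simp; ring
    rw [e1 _ d1, e1 _ d2, e1 _ d3, e1 _ d4, ← neg_div, eq_div_iff (by simp [*])]
    generalize hA : 1 - k = A at *
    generalize hB : 1 - a = B at *
    generalize hC : 1 - k * w = C at *
    generalize hD : 1 - a * w = D at *
    field_simp
    subst hA hB hC hD
    ring
  simp only [← div_eq_mul_inv] at hrat
  linear_combination -hrat

lemma qPochInf_zero_right (x : ℂ) : qPochInf x 0 = 1 - x := by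
  rw [qPochInf_eq_mul_qPochInf (by simp)]
  simp [qPochInf]

lemma admissible_of_forall_ne (hq : ‖q‖ < 1) (hq0 : q ≠ 0) (ha : a ≠ 0) (hz : z ≠ 0)
    (haq : ∀ m : ℤ, a ≠ q ^ m) (hkq : ∀ m : ℤ, k ≠ q ^ m)
    (hza : ∀ m : ℤ, z ≠ a * q ^ m) (hzk : ∀ m : ℤ, z ≠ k * q ^ m) : Admissible q a k z := by
  have aux : ∀ {x : ℂ}, (∀ m : ℤ, x ≠ q ^ m) → ∀ i : ℕ, 1 - x * q ^ i ≠ 0 := by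
    intro x hx i h0
    refine hx (-i) ?_
    rw [zpow_neg, zpow_natCast]
    exact eq_inv_of_mul_eq_one_left (sub_eq_zero.mp h0).symm
  have aux2 : ∀ {x : ℂ}, (∀ m : ℤ, z ≠ x * q ^ m) → ∀ i : ℕ, 1 - x / z * q ^ i ≠ 0 := by
    intro x hx i h0
    refine hx i ?_
    rw [zpow_natCast]
    have := sub_eq_zero.mp h0
    field_simp at this
    exact this
  exact ⟨hq, hq0, ha, hz, aux hkq, aux haq, aux2 hzk, aux2 hza⟩

lemma seriesHasSum_zero {u : ℕ → ℂ} (h : ∀ n, 1 ≤ n → u n = 0) : SeriesHasSum u 0 := by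
  refine tendsto_const_nhds.congr fun N => (Finset.sum_eq_zero fun n hn => ?_).symm
  rw [Finset.mem_Icc] at hn
  exact h n hn.1

end

end WPBailey

end

theorem theorem1
    (q a k z : ℂ) (α β : ℂ → ℂ → ℕ → ℂ)
    -- `rk` and `rk'` are any square roots of `k` and of `1/k`
    (rk rk' : ℂ) (hrk : rk ^ 2 = k) (hrk' : rk' ^ 2 = 1 / k)
    (hq : ‖q‖ < 1) (ha : a ≠ 0) (hk : k ≠ 0) (hz : z ≠ 0)
    -- the family is a WP-Bailey pair at the two pairs of parameters that occur
    (hpair : WPBailey.IsWPBaileyPair q a k (α a k) (β a k))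
    (hpair' : WPBailey.IsWPBaileyPair q (1 / a) (1 / k) (α (1 / a) (1 / k)) (β (1 / a) (1 / k)))
    -- no denominator vanishes
    (haq : ∀ m : ℤ, a ≠ q ^ m) (hkq : ∀ m : ℤ, k ≠ q ^ m)
    (hza : ∀ m : ℤ, z ≠ a * q ^ m) (hzk : ∀ m : ℤ, z ≠ k * q ^ m)
    -- convergence conditions: `|qa| < |z| < |a/q|`, and the two `α`-series converge
    (hconv : ‖q * a‖ < ‖z‖) (hconv' : ‖q * z‖ < ‖a‖)
    (A A' : ℂ)
    (hA : WPBailey.SeriesHasSum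
      (fun n => WPBailey.qPoch z q n * WPBailey.qPoch q q (n - 1) /
        WPBailey.qPochs [q * a, q * a / z] q n * (q * a / z) ^ n * α a k n) A)
    (hA' : WPBailey.SeriesHasSum
      (fun n => WPBailey.qPoch (1 / z) q n * WPBailey.qPoch q q (n - 1) /
        WPBailey.qPochs [q / a, q * z / a] q n * (q * z / a) ^ n * α (1 / a) (1 / k) n) A') :
    ∃ B B' : ℂ,
      WPBailey.SeriesHasSum
        (fun n => WPBailey.qPochs [q * rk, -q * rk, z] q n * WPBailey.qPoch q q (n - 1) /
          WPBailey.qPochs [rk, -rk, q * k, q * k / z] q n * (q * a / z) ^ n * β a k n) B ∧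
      WPBailey.SeriesHasSum
        (fun n => WPBailey.qPochs [q * rk', -q * rk', 1 / z] q n * WPBailey.qPoch q q (n - 1) /
          WPBailey.qPochs [rk', -rk', q / k, q * z / k] q n * (q * z / a) ^ n *
            β (1 / a) (1 / k) n) B' ∧
      B - B' - A + A' =
        (a - k) * (1 - 1 / z) * (1 - a * k / z) /
          ((1 - a) * (1 - k) * (1 - a / z) * (1 - k / z)) +
        z / k *
          (WPBailey.qPochsInf
              [z, q / z, k / a, q * a / k, a * k / z, q * z / (a * k), q, q] q /
            WPBailey.qPochsInf
              [z / k, q * k / z, z / a, q * a / z, a, q / a, k, q / k] q) := by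
  -- For `q = 0` shifting by `q^N` degenerates. Every term with `n ≥ 1` is zero, and the right side
  -- is a finite expression that vanishes.
  by_cases hq0 : q = 0
  · subst hq0
    have h0 : ∀ x y : ℂ, ∀ n, 1 ≤ n → (0 * x / y) ^ n = 0 := fun x y n hn => by
      rw [zero_mul, zero_div, zero_pow (by omega)]
    have hA0 : A = 0 := tendsto_nhds_unique hA
      (WPBailey.seriesHasSum_zero fun n hn => by
        rw [h0 _ _ n hn, mul_zero, zero_mul])
    have hA0' : A' = 0 := tendsto_nhds_unique hA'
      (WPBailey.seriesHasSum_zero fun n hn => by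
        rw [h0 _ _ n hn, mul_zero, zero_mul])
    refine ⟨0, 0,
      WPBailey.seriesHasSum_zero fun n hn => by
        rw [h0 _ _ n hn, mul_zero, zero_mul],
      WPBailey.seriesHasSum_zero fun n hn => by
        rw [h0 _ _ n hn, mul_zero, zero_mul], ?_⟩
    have d1 : 1 - a ≠ 0 := sub_ne_zero.mpr fun h => haq 0 (by simp [← h])
    have d2 : 1 - k ≠ 0 := sub_ne_zero.mpr fun h => hkq 0 (by simp [← h])
    have d3 : z - a ≠ 0 := sub_ne_zero.mpr fun h => hza 0 (by simp [← h])
    have d4 : z - k ≠ 0 := sub_ne_zero.mpr fun h => hzk 0 (by simp [← h])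
    have d5 : a - z ≠ 0 := by rw [← neg_sub]; exact neg_ne_zero.mpr d3
    have d6 : k - z ≠ 0 := by rw [← neg_sub]; exact neg_ne_zero.mpr d4
    rw [hA0, hA0']
    simp only [WPBailey.qPochsInf, WPBailey.qPochInf_zero_right, List.map_cons, List.map_nil,
      List.prod_cons, List.prod_nil, zero_mul, zero_div, sub_zero, mul_one, one_mul]
    have s1 : 1 - a / z = (z - a) / z := by field_simp
    have s2 : 1 - k / z = (z - k) / z := by field_simp
    have s3 : 1 - z / k = -(z - k) / k := by field_simp; ring
    have s4 : 1 - z / a = -(z - a) / a := by field_simp; ring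
    rw [s1, s2, s3, s4]
    generalize hC : z - a = C at *
    generalize hD : z - k = D at *
    field_simp
    ring
  · have inv_pow : ∀ m : ℤ, 1 / q ^ m = q ^ (-m) := fun m => by rw [zpow_neg, one_div]
    have h := WPBailey.admissible_of_forall_ne hq hq0 ha hz haq hkq hza hzk
    have h' : WPBailey.Admissible q (1 / a) (1 / k) (1 / z) := by
      refine WPBailey.admissible_of_forall_ne hq hq0 (one_div_ne_zero ha) (one_div_ne_zero hz)
        ?_ ?_ ?_ ?_
      · intro m h0; exact haq (-m) (by rw [← inv_pow, ← h0, one_div_one_div])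
      · intro m h0; exact hkq (-m) (by rw [← inv_pow, ← h0, one_div_one_div])
      · intro m h0
        refine hza (-m) ?_
        rw [← one_div_one_div z, h0, ← inv_pow, one_div_mul_eq_div, one_div_div, mul_one_div]
      · intro m h0
        refine hzk (-m) ?_
        rw [← one_div_one_div z, h0, ← inv_pow, one_div_mul_eq_div, one_div_div, mul_one_div]
    have hr : ‖q * a / z‖ < 1 := by
      rwa [norm_div, div_lt_one (norm_pos_iff.mpr hz)]
    have c1 : q / a / (1 / z) = q * z / a := by field_simp
    have c2 : q / k / (1 / z) = q * z / k := by field_simp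
    have hr' : ‖q * (1 / a) / (1 / z)‖ < 1 := by
      rwa [mul_one_div, c1, norm_div, div_lt_one (norm_pos_iff.mpr ha)]
    have hB := WPBailey.seriesHasSum_beta h hr hrk hpair hA
    have hB' := WPBailey.seriesHasSum_beta (A := A') h' hr' hrk' hpair'
      (by simp only [mul_one_div, c1]; exact hA')
    simp only [mul_one_div, c1, c2] at hB'
    refine ⟨_, _, hB, hB', ?_⟩
    -- `A` and `A'` cancel, leaving the difference of the two Lambert combinations.
    rw [← WPBailey.lambert_combination h h' hk]
    ring
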